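/- **Theorem 5.3 (moment map on $\hat{\mathcal M}(C_m)$).** Let $S^1=\mathbb R/2\pi\mathbb Z$, $D_s=d/ds$; all maps are smooth. *Curves and Hamiltonians.* Let $\hat{\mathcal M}$ be the space of closed curves $\hat\gamma:S^1\to\mathbb E^2=\mathbb C$ with $|\hat\gamma_s|\equiv1$, and let $\hat\kappa$ be the curvature, $T_s=\hat\kappa\, iT$ with $T=\hat\gamma_s$. Let $\hat\Omega=\frac12(D_s^2+\hat\kappa^2+\hat\kappa_sD_s^{-1}\hat\kappa)$, where on differential polynomials in $\hat\kappa$ the operator $D_s^{-1}$ is taken without constant term. For every $n\ge1$ there is a differential polynomial $\hat h_n$ in $\hat\kappa$ such that $2D_s\frac{\delta\hat H_n}{\delta\hat\kappa}=\hat\Omega^{n-1}\hat\kappa_s$ for $\hat H_n=\int_{S^1}\hat h_n\,ds$, and such that neither $\hat h_n$ nor $\delta\hat H_n/\delta\hat\kappa$ has a constant term (e.g. $\hat h_1=\frac14\hat\kappa^2$, $\hat h_2=\frac1{32}\hat\kappa^4-\frac18\hat\kappa_s^2$); this determines $\hat H_n:\hat{\mathcal M}\to\mathbb R$. For real numbers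 $C=\{c_k\}$ and $m\ge1$ let $$\hat{\mathcal M}(C_m)=\hat H_1^{-1}(c_1)\cap\dots\cap\hat H_m^{-1}(c_m),\qquad T_{\hat\gamma}\hat{\mathcal M}(C_m)=T_{\hat\gamma}\hat{\mathcal M}\cap\bigcap_{k=1}^m\ker (d\hat H_k)_{\hat\gamma},$$ where $T_{\hat\gamma}\hat{\mathcal M}$ consists of the velocities of smooth one-parameter families in $\hat{\mathcal M}$ through $\hat\gamma$. *The form.* Let $\mathcal M^{\mathbb C}$ be the space of curves $\gamma$ in $\mathbb C^2\setminus\{0\}$ with $\det(\gamma,\gamma_s)=1$ that are closed up to sign, $\gamma(s+2\pi)=\pm\gamma(s)$; let $\gamma_{ss}=-\kappa\gamma$ and $\Omega=\frac12D_s^2+2\kappa+\kappa_sD_s^{-1}$. For $X=-\frac12\alpha_s\gamma+\alpha\gamma_s$ and $Y=-\frac12\beta_s\gamma+\beta\gamma_s$ with $\alpha,\beta:S^1\to\mathbb C$ put $$\omega_{m+1}(X,Y)=\int_{S^1}\alpha\,\Omega^{m+1}\beta_s\,ds,$$ where $D_s^{-1}\beta_s=\beta$ and each further $D_s^{-1}$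 is any primitive on $S^1$, whenever these primitives exist. Let $\Phi(\hat\gamma)=(-\hat\gamma_s)^{-1/2}(\hat\gamma,1)\in\mathcal M^{\mathbb C}$, which is determined up to sign; $\omega_{m+1}$ does not change under $\gamma\mapsto-\gamma$. Put $\hat\omega_{m+1}=\Phi^*\omega_{m+1}$. *Claim.* On $T_{\hat\gamma}\hat{\mathcal M}(C_m)$, $\hat\gamma\in\hat{\mathcal M}(C_m)$, the form $\hat\omega_{m+1}$ is defined, does not depend on the choice of the primitives or of the sign of the root, and is real-valued, bilinear and skew-symmetric. The $S^1$-action $\hat\gamma\mapsto\hat\gamma(\,\cdot+\sigma)$ on $\hat{\mathcal M}(C_m)$ is Hamiltonian with respect to $\hat\omega_{m+1}$ with moment map $\hat\mu_{m+1}$ given by $$\hat\mu_{m+1}(\hat\gamma)\left(\frac{\partial}{\partial\sigma}\right)=\hat H_{m+1}(\hat\gamma),\qquad\hat\gamma\in\hat{\mathcal M}(C_m).$$ That is: the action preserves $\hat{\mathcal M}(C_m)$, its tangent spaces and $\hat\omega_{m+1}$; $\hat H_{m+1}$ is invariant; the fundamental vector field $\hat\gamma\mapsto\hat\gamma_s$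 of $\partial/\partial\sigma$ is tangent to $\hat{\mathcal M}(C_m)$; and $d\hat H_{m+1}(Y)=\hat\omega_{m+1}(\hat\gamma_s,Y)$ for all $Y\in T_{\hat\gamma}\hat{\mathcal M}(C_m)$. -/

import Mathlib

open scoped ContDiff

noncomputable section

namespace ClosedCurves

/-! ### Differential polynomials and the modified KdV hierarchy -/

/-- Differential polynomials in one unknown `u` over `ℝ`; the variable `X j` is the `j`-th
derivative of `u`. -/
abbrev DiffPoly : Type := MvPolynomial ℕ ℝ

/-- The total derivative `D_s`: the derivation with `u^(j) ↦ u^(j+1)`. -/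
def totalD : Derivation ℝ DiffPoly DiffPoly :=
  MvPolynomial.mkDerivation ℝ (fun j : ℕ => (MvPolynomial.X (j + 1) : DiffPoly))

/-- The variational derivative `∂p/∂u - D_s (∂p/∂u_s) + D_s² (∂p/∂u_ss) - ⋯`. -/
def varDeriv (p : DiffPoly) : DiffPoly :=
  ∑ j ∈ p.vars, (-1 : DiffPoly) ^ j * (fun q : DiffPoly => totalD q)^[j] (MvPolynomial.pderiv j p)

/-- `IsMKdVFlow n f` says that `f = Ω̂ⁿ u_s`, where
`Ω̂ = (1/2) (D_s² + u² + u_s D_s⁻¹ u)` is the recursion operator of the modified KdV equation.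
Here `w = D_s⁻¹ (u g)` is the differential polynomial without constant term with `D_s w = u g`. -/
def IsMKdVFlow : ℕ → DiffPoly → Prop
  | 0, f => f = MvPolynomial.X 1
  | n + 1, f => ∃ g w : DiffPoly, IsMKdVFlow n g ∧
      totalD w = MvPolynomial.X 0 * g ∧ MvPolynomial.constantCoeff w = 0 ∧
      f = MvPolynomial.C (1 / 2 : ℝ) *
        (totalD (totalD g) + MvPolynomial.X 0 ^ 2 * g + MvPolynomial.X 1 * w)

/-- `p` is a density of the `n`-th Hamiltonian (`n ≥ 1`) of the modified KdV hierarchy: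
`2 D_s (δ/δu ∫ p) = Ω̂ⁿ⁻¹ u_s`, where neither `p` nor its variational derivative has a constant
term. For example `u² / 4` for `n = 1` and `u⁴ / 32 - u_s² / 8` for `n = 2`. These conditions
determine `p` up to a total derivative, hence they determine the functional `∫ p ds`. -/
def IsMKdVDensity (n : ℕ) (p : DiffPoly) : Prop :=
  ∃ k : ℕ, n = k + 1 ∧ MvPolynomial.constantCoeff p = 0 ∧
    MvPolynomial.constantCoeff (varDeriv p) = 0 ∧
    IsMKdVFlow k (2 * totalD (varDeriv p))

/-! ### Closed curves in the Euclidean plane -/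

/-- The space of closed arc-length parametrized smooth curves in the Euclidean plane `ℂ`;
maps on `S¹ = ℝ / 2πℤ` are `2π`-periodic maps on `ℝ`. -/
def MHat : Set (ℝ → ℂ) :=
  {γ | ContDiff ℝ ∞ γ ∧ (∀ s, γ (s + 2 * Real.pi) = γ s) ∧ ∀ s, ‖deriv γ s‖ = 1}

/-- The Euclidean curvature `κ̂`, i.e. `T_s = κ̂ N` with `T = γ_s` and `N = i T`. -/
def curvHat (γ : ℝ → ℂ) (s : ℝ) : ℝ :=
  (star (deriv γ s) * deriv (deriv γ) s).im

/-- The functional `∫_{S¹} p(κ̂, κ̂_s, κ̂_ss, …) ds`. -/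
def functionalHat (p : DiffPoly) (γ : ℝ → ℂ) : ℝ :=
  ∫ s in (0 : ℝ)..(2 * Real.pi),
    MvPolynomial.eval (fun j : ℕ => iteratedDeriv j (curvHat γ) s) p

/-- The common level set of the first `m` Hamiltonians, with values `c 1, …, c m`. -/
def levelHat (h : ℕ → DiffPoly) (c : ℕ → ℝ) (m : ℕ) : Set (ℝ → ℂ) :=
  {γ | γ ∈ MHat ∧ ∀ k, 1 ≤ k → k ≤ m → functionalHat (h k) γ = c k}

/-- `Γ` is a smooth one-parameter family of closed arc-length parametrized curves which starts
at `γ` with velocity `V`. -/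
def IsMotion (Γ : ℝ → ℝ → ℂ) (γ V : ℝ → ℂ) : Prop :=
  ContDiff ℝ ∞ (fun x : ℝ × ℝ => Γ x.1 x.2) ∧ (∀ t, Γ t ∈ MHat) ∧ Γ 0 = γ ∧
    ∀ s, deriv (fun t => Γ t s) 0 = V s

/-- `V` is tangent at `γ` to the level set of the first `m` Hamiltonians: it is a tangent vector of
the space of closed curves (the velocity of a smooth family) and belongs to the kernels of the
differentials of these Hamiltonians. -/
def IsTangentHat (h : ℕ → DiffPoly) (m : ℕ) (γ V : ℝ → ℂ) : Prop :=
  ∃ Γ : ℝ → ℝ → ℂ, IsMotion Γ γ V ∧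
    ∀ k, 1 ≤ k → k ≤ m → HasDerivAt (fun t => functionalHat (h k) (Γ t)) 0 0

/-! ### Complex equicentroaffine curves and the forms `ω_k` -/

/-- The determinant of two vectors of `ℂ²`. -/
def det2 (v w : ℂ × ℂ) : ℂ := v.1 * w.2 - v.2 * w.1

/-- Complex equicentroaffine curves, closed up to sign. (The sign is needed because the square
root in the geometric Miura transformation changes sign along `S¹` when the rotation number of
the curve is odd. All quantities below are invariant under `γ ↦ -γ`.) -/
def MC : Set (ℝ → ℂ × ℂ) :=
  {γ | ContDiff ℝ ∞ γ ∧
    ((∀ s, γ (s + 2 * Real.pi) = γ s) ∨ (∀ s, γ (s + 2 * Real.pi) = -γ s)) ∧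
    ∀ s, det2 (γ s) (deriv γ s) = 1}

/-- The equicentroaffine curvature `κ`, i.e. `γ_ss = -κ γ`. -/
def curvC (γ : ℝ → ℂ × ℂ) (s : ℝ) : ℂ := det2 (deriv γ s) (deriv (deriv γ) s)

/-- Smooth complex functions on `S¹`. -/
def IsSmoothCircle (α : ℝ → ℂ) : Prop :=
  ContDiff ℝ ∞ α ∧ ∀ s, α (s + 2 * Real.pi) = α s

/-- `X = -(1/2) α_s γ + α γ_s` with a function `α` on `S¹`, i.e. `X` is the tangent vector at `γ`
to the space of equicentroaffine curves represented by `α`. -/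
def Represents (γ : ℝ → ℂ × ℂ) (α : ℝ → ℂ) (X : ℝ → ℂ × ℂ) : Prop :=
  IsSmoothCircle α ∧ ∀ s, X s = (-(1 / 2 : ℂ) * deriv α s) • γ s + α s • deriv γ s

/-- `b j = Ω^j β_s` for `j ≤ k`, where `Ω = (1/2) D_s² + 2 κ + κ_s D_s⁻¹` is the recursion operator
of the KdV equation and `a j = D_s⁻¹ (b j)`, `j < k`, are functions on `S¹`, the first of which is
`D_s⁻¹ β_s = β`. -/
structure IsOmegaIterates (κ β : ℝ → ℂ) (k : ℕ) (a b : ℕ → ℝ → ℂ) : Prop where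
  a_zero : a 0 = β
  b_zero : b 0 = deriv β
  circle : ∀ j, j < k → IsSmoothCircle (a j)
  primitive : ∀ j, j < k → deriv (a j) = b j
  step : ∀ j, j < k → ∀ s,
    b (j + 1) s = (1 / 2 : ℂ) * deriv (deriv (b j)) s + 2 * κ s * b j s + deriv κ s * a j s

/-- `ω_k(X, Y) = w`, where `ω_k(X, Y) = ∫_{S¹} α Ω^k β_s ds` for `X = -(1/2) α_s γ + α γ_s` and
`Y = -(1/2) β_s γ + β γ_s`. This is a relation, because `Ω^k β_s` exists only under conditions on
`Y`, and the constants of integration in it drop out only under conditions on `X`. -/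
def HasOmega (k : ℕ) (γ X Y : ℝ → ℂ × ℂ) (w : ℂ) : Prop :=
  γ ∈ MC ∧ ∃ (α β : ℝ → ℂ) (a b : ℕ → ℝ → ℂ),
    Represents γ α X ∧ Represents γ β Y ∧ IsOmegaIterates (curvC γ) β k a b ∧
    w = ∫ s in (0 : ℝ)..(2 * Real.pi), α s * b k s

/-! ### The geometric Miura transformation -/

/-- `δ = Φ(γ) = (-γ_s)^(-1/2) (γ, 1)`, with one of the two smooth branches `ρ` of the root. -/
def IsMiura (γ : ℝ → ℂ) (δ : ℝ → ℂ × ℂ) : Prop :=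
  ∃ ρ : ℝ → ℂ, ContDiff ℝ ∞ ρ ∧ (∀ s, ρ s ^ 2 * (-deriv γ s) = 1) ∧
    ∀ s, δ s = (ρ s * γ s, ρ s)

/-- `W = Φ_* V` at `δ = Φ(γ)`: the velocity at `δ` of the image under `Φ` of a smooth family that
starts at `γ` with velocity `V`. -/
def IsMiuraPush (γ : ℝ → ℂ) (δ : ℝ → ℂ × ℂ) (V : ℝ → ℂ) (W : ℝ → ℂ × ℂ) : Prop :=
  ∃ (Γ : ℝ → ℝ → ℂ) (Δ : ℝ → ℝ → ℂ × ℂ), IsMotion Γ γ V ∧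
    ContDiff ℝ ∞ (fun x : ℝ × ℝ => Δ x.1 x.2) ∧ (∀ t, IsMiura (Γ t) (Δ t)) ∧ Δ 0 = δ ∧
    ∀ s, W s = deriv (fun t => Δ t s) 0

/-- `(Φ^* ω_k)(V, V') = w` at `γ`. -/
def HasOmegaHat (k : ℕ) (γ V V' : ℝ → ℂ) (w : ℂ) : Prop :=
  ∃ (δ W W' : ℝ → ℂ × ℂ), IsMiura γ δ ∧ IsMiuraPush γ δ V W ∧ IsMiuraPush γ δ V' W' ∧
    HasOmega k δ W W' w

/-! ### The circle action and its moment map -/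

/-- The action of `σ ∈ S¹ = ℝ / 2πℤ` by parameter shift. -/
def shift (σ : ℝ) (γ : ℝ → ℂ) : ℝ → ℂ := fun s => γ (s + σ)

/-- The fundamental vector field of `∂/∂σ`. -/
def fundamentalField (γ : ℝ → ℂ) : ℝ → ℂ := fun s => deriv (fun σ => shift σ γ s) 0

/-- `form` is a skew-symmetric bilinear form on the tangent spaces `Tan γ`, `γ ∈ M`. -/
structure IsTwoForm (M : Set (ℝ → ℂ)) (Tan : (ℝ → ℂ) → (ℝ → ℂ) → Prop)
    (form : (ℝ → ℂ) → (ℝ → ℂ) → (ℝ → ℂ) → ℝ) : Prop where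
  skew : ∀ γ ∈ M, ∀ V V', Tan γ V → Tan γ V' → form γ V V' = -form γ V' V
  linear : ∀ γ ∈ M, ∀ (V V₁ V₂ V₃ : ℝ → ℂ) (r : ℝ), Tan γ V → Tan γ V₁ → Tan γ V₂ → Tan γ V₃ →
    (∀ s, V₃ s = r * V₁ s + V₂ s) → form γ V V₃ = r * form γ V V₁ + form γ V V₂

/-- The `S¹`-action by parameter shift on `M` (a subset of the space of closed curves, with tangent
spaces `Tan γ`) is Hamiltonian with respect to `form`, and `μ` is (the value on `∂/∂σ` of) its
moment map: the action preserves `M`, its tangent spaces, and `form`; `μ` is invariant; and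
`dμ = form(A, ·)` for the fundamental vector field `A` of `∂/∂σ`. -/
structure IsShiftMomentMap (M : Set (ℝ → ℂ)) (Tan : (ℝ → ℂ) → (ℝ → ℂ) → Prop)
    (form : (ℝ → ℂ) → (ℝ → ℂ) → (ℝ → ℂ) → ℝ) (μ : (ℝ → ℂ) → ℝ) : Prop where
  maps : ∀ γ ∈ M, ∀ σ, shift σ γ ∈ M
  maps_tangent : ∀ γ ∈ M, ∀ σ V, Tan γ V → Tan (shift σ γ) (shift σ V)
  form_invariant : ∀ γ ∈ M, ∀ σ V V', Tan γ V → Tan γ V' →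
    form (shift σ γ) (shift σ V) (shift σ V') = form γ V V'
  moment_invariant : ∀ γ ∈ M, ∀ σ, μ (shift σ γ) = μ γ
  fundamental_tangent : ∀ γ ∈ M, Tan γ (fundamentalField γ)
  differential : ∀ γ ∈ M, ∀ V, Tan γ V → ∀ Γ, IsMotion Γ γ V →
    HasDerivAt (fun t => μ (Γ t)) (form γ (fundamentalField γ) V) 0

end ClosedCurves

end

noncomputable section

namespace ClosedCurves

section

open MvPolynomial

/-! ### Total derivatives and evolutionary derivations -/

/-! Write a deformation as `V = q T` with `T = γ_s`, and put `u = κ̂`. Preserving arc length means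
`q_s + i u q = i l` with a real function `l`, the angular velocity of `T`, and then `u_t = l_s`. The
Miura map sends `V` to the vector represented by `α = q` itself, and the centroaffine curvature of
the image is `κ = u²/4 + i u_s/2`. For this `κ` the Lenard operator factors, `L = Ω D_s = ½ (D_s - i
u) D_s (D_s + i u)`, so `L q = ½ (u l_s + i l_ss)`. A periodic primitive exists iff `∫ u l_s = 0`. A
primitive `½ (w + i l_s)` with `w` real is again of the same form, with new angular velocity `½
(l_ss + u w)`: one step of `Ω̂` on `l_s`.

The rest is skewness of `L` and `D_s`. For chains with `D_s q_{j+1} = L q_j` it gives `∫ p₀ L q_m =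
∫ p_m L q₀` (`IsLenardChain.swap`), so the form does not see the choice of primitives and is skew.
The field `γ_s` has `q = 1`, and its chain (`shiftChain`) has the mKdV gradients as angular
velocities. Swapping against it turns the obstruction `∫ u (l_j)_s` into `2 dĤ_{j+1}(V)`. Tangency
to the level set removes the obstructions to the `m` primitives that are needed, and the next such
integral is the moment map identity `ω(γ_s, V) = dĤ_{m+1}(V)`.

Existence of the Hamiltonians is algebraic. Lenard's ladder shows that the gradients are
differential polynomials (`mul_totalD_gradPoly_mem`), and a trace identity, `δ/δu ∫ potPoly n = (2 n
+ 1) gradPoly n`, integrates them (`trace_identity`). -/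

/-- The evolutionary derivation with characteristic `v`: it sends `u^(j)` to `D_s^j v`. -/
def evolD (v : DiffPoly) : Derivation ℝ DiffPoly DiffPoly :=
  mkDerivation ℝ (fun j : ℕ => (fun q : DiffPoly => totalD q)^[j] v)

theorem totalD_X (j : ℕ) : totalD (X j) = X (j + 1) := by
  simp [totalD, mkDerivation_X]

theorem evolD_X (v : DiffPoly) (j : ℕ) :
    evolD v (X j) = (fun q : DiffPoly => totalD q)^[j] v := by
  simp [evolD, mkDerivation_X]

/-- The commutator of two derivations is a derivation, so it suffices to test it on the variables.
-/
theorem evolD_totalD (v p : DiffPoly) : evolD v (totalD p) = totalD (evolD v p) := by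
  have h : ⁅evolD v, totalD⁆ = 0 := by
    apply derivation_ext
    intro i
    simp only [Derivation.commutator_apply, totalD_X, evolD_X, Function.iterate_succ_apply',
      sub_self, Derivation.coe_zero, Pi.zero_apply]
  have h2 := congrArg (fun d : Derivation ℝ DiffPoly DiffPoly => d p) h
  simp only [Derivation.commutator_apply, Derivation.coe_zero, Pi.zero_apply] at h2
  exact sub_eq_zero.mp h2

/-- Again a commutator of derivations, tested on the variables. It serves to compare the order of a
polynomial with that of its total derivative. -/
theorem pderiv_succ_totalD (i : ℕ) (p : DiffPoly) :
    pderiv (i + 1) (totalD p) = totalD (pderiv (i + 1) p) + pderiv i p := by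
  have h : ⁅(pderiv (i + 1) : Derivation ℝ DiffPoly DiffPoly), totalD⁆ = (pderiv i : Derivation ℝ DiffPoly DiffPoly) := by
    apply derivation_ext
    intro j
    rw [Derivation.commutator_apply, totalD_X]
    by_cases hj : j = i
    · subst hj
      simp
    · have h1 : j + 1 ≠ i + 1 := by omega
      rw [pderiv_X_of_ne h1, pderiv_X_of_ne hj]
      by_cases hj' : j = i + 1
      · subst hj'
        simp
      · rw [pderiv_X_of_ne hj']
        simp
  have h2 := congrArg (fun d : Derivation ℝ DiffPoly DiffPoly => d p) h
  simp only [Derivation.commutator_apply] at h2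
  rw [← h2]
  ring

theorem exists_forall_pderiv_eq_zero (p : DiffPoly) : ∃ N : ℕ, ∀ i, N ≤ i → pderiv i p = 0 := by
  refine ⟨p.vars.sup id + 1, fun i hi => pderiv_eq_zero_of_notMem_vars fun h => ?_⟩
  have := Finset.le_sup (f := id) h
  simp only [id] at this
  omega

/-- `totalD` raises the order by one. -/
theorem pderiv_eq_zero_of_totalD {N : ℕ} {p : DiffPoly}
    (h : ∀ i, N < i → pderiv i (totalD p) = 0) : ∀ i, N ≤ i → pderiv i p = 0 := by
  obtain ⟨M, hM⟩ := exists_forall_pderiv_eq_zero p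
  intro i hi
  by_cases hMi : M ≤ i
  · exact hM i hMi
  -- Descend from a bound `M` on the order: once `∂p/∂u^(k+1) = 0`, the commutator formula leaves
  -- only `∂p/∂u^(k)`.
  · refine Nat.decreasingInduction' (P := fun k => N ≤ k → pderiv k p = 0) (m := i) (n := M)
      (fun k _ _ ih hk => ?_) (by omega) (fun _ => hM M le_rfl) hi
    have h1 := h (k + 1) (by omega)
    rw [pderiv_succ_totalD, ih (by omega), map_zero, zero_add] at h1
    exact h1

theorem eq_C_of_pderiv_eq_zero {p : DiffPoly} (h : ∀ i, pderiv i p = 0) :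
    p = C (constantCoeff p) := by
  ext m
  by_cases hm : m = 0
  · subst hm
    simp [constantCoeff_eq]
  · obtain ⟨i, hi⟩ : ∃ i, m i ≠ 0 := by
      by_contra hcon
      push Not at hcon
      exact hm (Finsupp.ext hcon)
    -- The coefficient of `m` reappears in `pderiv i p` multiplied by the positive exponent `m i`.
    have h1 := coeff_pderiv (i := i) p (m - Finsupp.single i 1)
    have h2 : m - Finsupp.single i 1 + Finsupp.single i 1 = m := by
      apply tsub_add_cancel_of_le
      rw [Finsupp.single_le_iff]
      omega
    rw [h i, h2] at h1
    rw [coeff_C, if_neg (Ne.symm hm)]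
    refine (mul_eq_zero.mp h1.symm).resolve_right (by positivity)

/-- All partial derivatives vanish, so the kernel of `D_s` consists of constants. Hence `D_s⁻¹`
without constant term is single-valued. -/
theorem eq_zero_of_totalD_eq_zero {p : DiffPoly} (h : totalD p = 0)
    (hc : constantCoeff p = 0) : p = 0 := by
  have h1 := pderiv_eq_zero_of_totalD (N := 0) (p := p) (by simp [h])
  rw [eq_C_of_pderiv_eq_zero fun i => h1 i (Nat.zero_le i), hc, C_0]

theorem eq_of_totalD_eq {p q : DiffPoly} (h : totalD p = totalD q)
    (hc : constantCoeff p = constantCoeff q) : p = q :=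
  sub_eq_zero.mp (eq_zero_of_totalD_eq_zero (by rw [map_sub, h, sub_self])
    (by rw [map_sub, hc, sub_self]))

theorem constantCoeff_totalD (p : DiffPoly) : constantCoeff (totalD p) = 0 := by
  induction p using MvPolynomial.induction_on with
  | C a => simp [totalD]
  | add p q hp hq => simp [hp, hq]
  | mul_X p i hp => simp [Derivation.leibniz, totalD_X]

/-! ### Differential polynomials modulo total derivatives; the variational derivative. -/

/-- The total derivatives. -/
def exactPolys : Submodule ℝ DiffPoly := LinearMap.range (totalD : DiffPoly →ₗ[ℝ] DiffPoly)

theorem totalD_mem_exactPolys (p : DiffPoly) : totalD p ∈ exactPolys := ⟨p, rfl⟩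

/-- A total derivative is affine in its highest derivative of `u`. Testing with the square of a
derivative beyond the order of `r` contradicts this unless `r = 0`. -/
theorem eq_zero_of_forall_mul_mem_exactPolys {r : DiffPoly}
    (h : ∀ v, r * v ∈ exactPolys) : r = 0 := by
  obtain ⟨N, hN⟩ := exists_forall_pderiv_eq_zero r
  obtain ⟨q, hq⟩ := h (X (N + 1) ^ 2)
  have hq : totalD q = r * X (N + 1) ^ 2 := hq
  have h0 : ∀ i, N + 1 ≤ i → pderiv i q = 0 := by
    apply pderiv_eq_zero_of_totalD
    intro i hi
    rw [hq, pderiv_mul, hN i (by omega), pderiv_pow, pderiv_X_of_ne (by omega)]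
    simp
  have h1 : pderiv (N + 1) (totalD q) = pderiv N q := by
    rw [pderiv_succ_totalD, h0 (N + 1) le_rfl, map_zero, zero_add]
  have h2 : pderiv (N + 1) (pderiv N q) = pderiv N (pderiv (N + 1) q) := by
    have : ⁅(pderiv (N + 1) : Derivation ℝ DiffPoly DiffPoly), pderiv N⁆ = (0 : Derivation ℝ DiffPoly DiffPoly) := by
      apply derivation_ext
      intro i
      classical
      rw [Derivation.commutator_apply, pderiv_X, pderiv_X]
      simp only [Pi.single_apply]
      split_ifs <;> simp
    have h2 := congrArg (fun d : Derivation ℝ DiffPoly DiffPoly => d q) this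
    simp only [Derivation.commutator_apply, Derivation.coe_zero, Pi.zero_apply] at h2
    exact sub_eq_zero.mp h2
  -- Now `h2` says that the second derivative of `r * X (N + 1) ^ 2` in `X (N + 1)`, which is `2 r`,
  -- vanishes.
  rw [h0 (N + 1) le_rfl, map_zero, ← h1, hq] at h2
  rw [pderiv_mul, hN (N + 1) (by omega), pderiv_pow, pderiv_X_self, zero_mul, zero_add,
    pderiv_mul, hN (N + 1) (by omega)] at h2
  have h3 : pderiv (N + 1) (2 : DiffPoly) = 0 := Derivation.map_natCast _ 2
  have h4 : r = 0 ∨ 2 + X (N + 1) * (pderiv (N + 1)) (2 : DiffPoly) = 0 := by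
    simpa [pderiv_mul, pderiv_one] using h2
  simpa [h3] using h4

/-- Integration by parts, `j` times; the induction moves one `D_s` onto `q`, which therefore varies.
-/
theorem pow_totalD_mul_sub_mem (j : ℕ) (q v : DiffPoly) :
    q * (fun q : DiffPoly => totalD q)^[j] v
      - (-1) ^ j * (fun q : DiffPoly => totalD q)^[j] q * v ∈ exactPolys := by
  induction j generalizing q with
  | zero => simp
  | succ j ih =>
    have h1 := ih (totalD q)
    have h2 := totalD_mem_exactPolys (q * (fun q : DiffPoly => totalD q)^[j] v)
    have h3 := exactPolys.sub_mem h2 h1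
    rw [Function.iterate_succ_apply', Function.iterate_succ_apply]
    convert h3 using 1
    rw [Derivation.leibniz, smul_eq_mul, smul_eq_mul]
    ring

theorem evolD_eq_sum (v p : DiffPoly) :
    evolD v p = ∑ j ∈ p.vars, pderiv j p * (fun q : DiffPoly => totalD q)^[j] v := by
  have key : ∀ s : Finset ℕ, p.vars ⊆ s →
      evolD v p = ∑ j ∈ s, pderiv j p * (fun q : DiffPoly => totalD q)^[j] v := by
    intro s hs
    have h : ∀ d : Derivation ℝ DiffPoly DiffPoly,
        d = ∑ j ∈ s, ((fun q : DiffPoly => totalD q)^[j] v) • pderiv j →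
        evolD v p = d p := by
      rintro d rfl
      refine derivation_eq_of_forall_mem_vars fun i hi => ?_
      rw [evolD_X]
      have h3 : ∀ d : Finset ℕ, (∑ j ∈ d, ((fun q : DiffPoly => totalD q)^[j] v) •
          (pderiv j : Derivation ℝ DiffPoly DiffPoly)) (X i) =
          ∑ j ∈ d, ((fun q : DiffPoly => totalD q)^[j] v) * pderiv j (X i) := by
        intro d
        induction d using Finset.induction_on with
        | empty => simp
        | insert a t ha ih =>
          rw [Finset.sum_insert ha, Finset.sum_insert ha, Derivation.add_apply, ih]
          simp
      rw [h3, Finset.sum_eq_single i]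
      · simp
      · intro b _ hb
        rw [pderiv_X_of_ne hb.symm, mul_zero]
      · intro h
        exact absurd (hs hi) h
    rw [h _ rfl]
    clear h hs
    induction s using Finset.induction_on with
    | empty => simp
    | insert a t ha ih =>
      rw [Finset.sum_insert ha, Finset.sum_insert ha, Derivation.add_apply, ih]
      simp [mul_comm]
  exact key _ subset_rfl

theorem evolD_sub_varDeriv_mul_mem (v p : DiffPoly) :
    evolD v p - varDeriv p * v ∈ exactPolys := by
  rw [evolD_eq_sum, varDeriv, Finset.sum_mul, ← Finset.sum_sub_distrib]
  exact exactPolys.sum_mem fun j _ => pow_totalD_mul_sub_mem j _ v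

/-- The first variation formula modulo total derivatives determines the gradient, since its test
functions separate points. -/
theorem varDeriv_eq_of_forall {p q : DiffPoly}
    (h : ∀ v, evolD v p - q * v ∈ exactPolys) : varDeriv p = q := by
  refine sub_eq_zero.mp (eq_zero_of_forall_mul_mem_exactPolys fun v => ?_)
  have := exactPolys.sub_mem (h v) (evolD_sub_varDeriv_mul_mem v p)
  convert this using 1
  ring


/-! ### Locality of the modified KdV hierarchy -/

/-- The primitive without constant term of a total derivative. -/
def dPrim (p : DiffPoly) : DiffPoly :=
  Classical.epsilon fun w => totalD w = p ∧ constantCoeff w = 0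

theorem dPrim_spec {p : DiffPoly} (h : p ∈ exactPolys) :
    totalD (dPrim p) = p ∧ constantCoeff (dPrim p) = 0 := by
  obtain ⟨q, hq⟩ := h
  have hq : totalD q = p := hq
  refine Classical.epsilon_spec (p := fun w => totalD w = p ∧ constantCoeff w = 0)
    ⟨q - C (constantCoeff q), ?_, ?_⟩
  · rw [map_sub, hq, totalD, derivation_C, sub_zero]
  · simp

/-- The gradients of the modified KdV hierarchy: `D_s (gradPoly n) = Ω̂ⁿ u_s`. -/
def gradPoly : ℕ → DiffPoly
  | 0 => X 0
  | n + 1 => C (1 / 2 : ℝ) * (totalD (totalD (gradPoly n))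
      + X 0 * dPrim (X 0 * totalD (gradPoly n)))

/-- The differential polynomials `D_s⁻¹ (u Ω̂ⁿ u_s)`. -/
def potPoly (n : ℕ) : DiffPoly := dPrim (X 0 * totalD (gradPoly n))

theorem gradPoly_succ (n : ℕ) : gradPoly (n + 1) =
    C (1 / 2 : ℝ) * (totalD (totalD (gradPoly n)) + X 0 * potPoly n) := rfl

theorem totalD_C_mul (a : ℝ) (p : DiffPoly) : totalD (C a * p) = C a * totalD p := by
  rw [C_mul', Derivation.map_smul, C_mul']

theorem two_mul_gradPoly_succ (n : ℕ) :
    2 * gradPoly (n + 1) = totalD (totalD (gradPoly n)) + X 0 * potPoly n := by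
  rw [gradPoly_succ, ← mul_assoc, show (2 : DiffPoly) = C 2 from rfl, ← C_mul]
  norm_num

/-- Both `D_s` and `P = Ω̂ D_s` are skew, and `D_s g_{k+1} = P g_k`; so an index moves from one
gradient to the other modulo exact terms. The hypotheses ask for locality only at `j` and `k`, which
permits use inside the induction proving it. -/
theorem gradPoly_mul_totalD_sub_mem {j k : ℕ}
    (hj : totalD (potPoly j) = X 0 * totalD (gradPoly j))
    (hk : totalD (potPoly k) = X 0 * totalD (gradPoly k)) :
    gradPoly j * totalD (gradPoly (k + 1)) - gradPoly (j + 1) * totalD (gradPoly k)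
      ∈ exactPolys := by
  refine ⟨C (1 / 2 : ℝ) * (gradPoly j * (totalD (totalD (gradPoly k)) + X 0 * potPoly k)
    - totalD (gradPoly j) * totalD (gradPoly k) - potPoly j * potPoly k), ?_⟩
  change totalD _ = _
  rw [gradPoly_succ k, gradPoly_succ j, totalD_C_mul, totalD_C_mul]
  simp only [map_add, map_sub, Derivation.leibniz, smul_eq_mul, hj, hk]
  ring

/-- Lenard's ladder: moving the index `n` step by step onto the other factor gives `g_0 D_s g_n ≡
g_n D_s g_0`. Until this is known, `potPoly n` could be an arbitrary default value. -/
theorem mul_totalD_gradPoly_mem (n : ℕ) : X 0 * totalD (gradPoly n) ∈ exactPolys := by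
  induction n using Nat.strong_induction_on with
  | _ n ih =>
    have hpot : ∀ j, j < n → totalD (potPoly j) = X 0 * totalD (gradPoly j) :=
      fun j hj => (dPrim_spec (ih j hj)).1
    have hmove : ∀ j, j ≤ n →
        gradPoly 0 * totalD (gradPoly n) - gradPoly j * totalD (gradPoly (n - j))
          ∈ exactPolys := by
      intro j
      induction j with
      | zero => simp
      | succ j ihj =>
        intro hj
        have h1 := gradPoly_mul_totalD_sub_mem (hpot j (by omega)) (hpot (n - (j + 1)) (by omega))
        rw [show n - (j + 1) + 1 = n - j by omega] at h1
        have h2 := exactPolys.add_mem (ihj (by omega)) h1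
        convert h2 using 1
        ring
    have h1 := hmove n le_rfl
    rw [Nat.sub_self] at h1
    -- Adding `D_s (g_n g_0)` turns the antisymmetric difference into `2 u D_s g_n`.
    have h2 := exactPolys.add_mem h1 (totalD_mem_exactPolys (gradPoly n * gradPoly 0))
    have h3 : C (2 : ℝ) * (X 0 * totalD (gradPoly n)) ∈ exactPolys := by
      convert h2 using 1
      rw [Derivation.leibniz, smul_eq_mul, smul_eq_mul, show (C 2 : DiffPoly) = 2 from rfl,
        show gradPoly 0 = X 0 from rfl]
      ring
    rw [C_mul'] at h3
    exact (exactPolys.smul_mem_iff (two_ne_zero)).mp h3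

theorem totalD_potPoly (n : ℕ) : totalD (potPoly n) = X 0 * totalD (gradPoly n) :=
  (dPrim_spec (mul_totalD_gradPoly_mem n)).1

theorem constantCoeff_potPoly (n : ℕ) : constantCoeff (potPoly n) = 0 :=
  (dPrim_spec (mul_totalD_gradPoly_mem n)).2

theorem constantCoeff_gradPoly (n : ℕ) : constantCoeff (gradPoly n) = 0 := by
  cases n with
  | zero => simp [gradPoly]
  | succ n => simp [gradPoly_succ, constantCoeff_totalD]

theorem isMKdVFlow_gradPoly (n : ℕ) : IsMKdVFlow n (totalD (gradPoly n)) := by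
  induction n with
  | zero => exact totalD_X 0
  | succ n ih =>
    refine ⟨_, potPoly n, ih, totalD_potPoly n, constantCoeff_potPoly n, ?_⟩
    rw [gradPoly_succ, totalD_C_mul, map_add, Derivation.leibniz, totalD_potPoly, totalD_X]
    simp only [smul_eq_mul]
    ring

theorem IsMKdVFlow.eq_totalD_gradPoly {n : ℕ} {f : DiffPoly} (h : IsMKdVFlow n f) :
    f = totalD (gradPoly n) := by
  induction n generalizing f with
  | zero => exact h.trans (totalD_X 0).symm
  | succ n ih =>
    obtain ⟨g, w, hg, hw, hw0, rfl⟩ := h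
    obtain rfl := ih hg
    have hwe : w = potPoly n := eq_of_totalD_eq (by rw [hw, totalD_potPoly])
      (by rw [hw0, constantCoeff_potPoly])
    rw [hwe, gradPoly_succ, totalD_C_mul, map_add, Derivation.leibniz, totalD_potPoly, totalD_X]
    simp only [smul_eq_mul]
    ring

/-- The flow fixes the gradient up to a constant, and the normalization of constant terms fixes it
completely. Thus any admissible choice of densities gives the same gradients. -/
theorem IsMKdVDensity.two_mul_varDeriv {k : ℕ} {p : DiffPoly} (h : IsMKdVDensity (k + 1) p) :
    2 * varDeriv p = gradPoly k := by
  obtain ⟨k', hk, -, hc, hf⟩ := h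
  obtain rfl : k = k' := by omega
  refine eq_of_totalD_eq ?_ ?_
  · rw [← hf.eq_totalD_gradPoly, show (2 : DiffPoly) = C 2 from rfl, totalD_C_mul]
  · rw [map_mul, hc, mul_zero, constantCoeff_gradPoly]

/-! ### Generating functions and the variational derivatives of the densities -/

/-- A derivation of the coefficients, applied to power series. -/
def coeffDeriv (d : Derivation ℝ DiffPoly DiffPoly) :
    Derivation ℝ (PowerSeries DiffPoly) (PowerSeries DiffPoly) :=
  Derivation.mk'
    { toFun := fun f => PowerSeries.mk fun n => d (PowerSeries.coeff n f)
      map_add' := fun f g => by ext1 n; simp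
      map_smul' := fun r f => by ext1 n; simp }
    fun f g => by
      ext1 n
      simp only [LinearMap.coe_mk, AddHom.coe_mk, PowerSeries.coeff_mk, PowerSeries.coeff_mul,
        map_sum, Derivation.leibniz, map_add, smul_eq_mul, Finset.sum_add_distrib]
      congr 1
      rw [← Finset.Nat.sum_antidiagonal_swap]
      rfl

theorem coeff_coeffDeriv (d : Derivation ℝ DiffPoly DiffPoly) (f : PowerSeries DiffPoly) (n : ℕ) :
    PowerSeries.coeff n (coeffDeriv d f) = d (PowerSeries.coeff n f) := by
  simp [coeffDeriv]

theorem coeffDeriv_X (d : Derivation ℝ DiffPoly DiffPoly) :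
    coeffDeriv d PowerSeries.X = 0 := by
  ext1 n
  rw [coeff_coeffDeriv, PowerSeries.coeff_X]
  split_ifs <;> simp

theorem coeffDeriv_C (d : Derivation ℝ DiffPoly DiffPoly) (p : DiffPoly) :
    coeffDeriv d (PowerSeries.C p) = PowerSeries.C (d p) := by
  ext1 n
  rw [coeff_coeffDeriv, PowerSeries.coeff_C, PowerSeries.coeff_C]
  split_ifs <;> simp

/-- The derivation `z d/dz` of power series. -/
def eulerD : Derivation ℝ (PowerSeries DiffPoly) (PowerSeries DiffPoly) :=
  Derivation.mk'
    { toFun := fun f => PowerSeries.mk fun n => (n : DiffPoly) * PowerSeries.coeff n f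
      map_add' := fun f g => by ext1 n; simp [mul_add]
      map_smul' := fun r f => by ext1 n; simp }
    fun f g => by
      ext1 n
      simp only [LinearMap.coe_mk, AddHom.coe_mk, PowerSeries.coeff_mk, PowerSeries.coeff_mul,
        map_add, smul_eq_mul]
      have h : ∑ p ∈ Finset.HasAntidiagonal.antidiagonal n, PowerSeries.coeff p.1 g *
            ((p.2 : DiffPoly) * PowerSeries.coeff p.2 f) =
          ∑ p ∈ Finset.HasAntidiagonal.antidiagonal n, PowerSeries.coeff p.2 g *
            ((p.1 : DiffPoly) * PowerSeries.coeff p.1 f) := by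
        rw [← Finset.Nat.sum_antidiagonal_swap]
        rfl
      rw [h, ← Finset.sum_add_distrib, Finset.mul_sum]
      refine Finset.sum_congr rfl fun p hp => ?_
      rw [← Finset.HasAntidiagonal.mem_antidiagonal.mp hp, Nat.cast_add]
      ring

theorem coeff_eulerD (f : PowerSeries DiffPoly) (n : ℕ) :
    PowerSeries.coeff n (eulerD f) = (n : DiffPoly) * PowerSeries.coeff n f := by
  simp [eulerD]

theorem eulerD_X : eulerD PowerSeries.X = PowerSeries.X := by
  ext1 n
  rw [coeff_eulerD, PowerSeries.coeff_X]
  split_ifs with h <;> simp [h]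

theorem eulerD_C (p : DiffPoly) : eulerD (PowerSeries.C p) = 0 := by
  ext1 n
  rw [coeff_eulerD, PowerSeries.coeff_C]
  split_ifs with h <;> simp [h]

theorem eulerD_coeffDeriv (d : Derivation ℝ DiffPoly DiffPoly) (f : PowerSeries DiffPoly) :
    coeffDeriv d (eulerD f) = eulerD (coeffDeriv d f) := by
  ext1 n
  rw [coeff_eulerD, coeff_coeffDeriv, coeff_coeffDeriv, coeff_eulerD, Derivation.leibniz,
    Derivation.map_natCast]
  simp

/-! ### The spectral problem and the trace identity. -/

/-- The generating function of the gradients. -/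
def gradSeries : PowerSeries DiffPoly := PowerSeries.mk gradPoly

/-- The generating function of the potentials, with the constant of integration that makes the
recursion homogeneous. -/
def potSeries : PowerSeries DiffPoly :=
  2 + PowerSeries.X * PowerSeries.mk potPoly

theorem X_mul_coeffDeriv_gradSeries :
    PowerSeries.X * coeffDeriv totalD (coeffDeriv totalD gradSeries)
      = 2 * gradSeries - PowerSeries.C (X 0) * potSeries := by
  have h : 2 * gradSeries = PowerSeries.C (X 0) * 2 + PowerSeries.X *
      (coeffDeriv totalD (coeffDeriv totalD gradSeries)
        + PowerSeries.C (X 0) * PowerSeries.mk potPoly) := by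
    ext1 n
    rw [show (2 : PowerSeries DiffPoly) = PowerSeries.C 2 from rfl]
    cases n with
    | zero => simp [gradSeries, gradPoly, mul_comm]
    | succ n =>
      rw [map_add, PowerSeries.coeff_succ_X_mul, ← map_mul, PowerSeries.coeff_C]
      simp [gradSeries, coeff_coeffDeriv, two_mul_gradPoly_succ]
  rw [h, potSeries]
  ring

theorem coeffDeriv_potSeries : coeffDeriv totalD potSeries
    = PowerSeries.X * PowerSeries.C (X 0) * coeffDeriv totalD gradSeries := by
  have h2 : coeffDeriv totalD (2 : PowerSeries DiffPoly) = 0 := Derivation.map_natCast _ 2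
  rw [potSeries, map_add, h2, Derivation.leibniz, coeffDeriv_X, smul_zero, add_zero, zero_add,
    smul_eq_mul, mul_assoc]
  congr 1
  ext1 n
  simp [coeff_coeffDeriv, gradSeries, totalD_potPoly]

/-- In the unknowns `y = (√z L, z D_s L, Q)`, with `L = gradSeries` and `Q = potSeries`, the two
recursions form a linear system that preserves `y₃² + y₂² - 2 y₁²`. The value of this first integral
is read off from constant terms, where only the `2` in `potSeries` survives. -/
theorem series_norm :
    potSeries ^ 2 + PowerSeries.X ^ 2 * (coeffDeriv totalD gradSeries) ^ 2
      - 2 * PowerSeries.X * gradSeries ^ 2 = 4 := by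
  set N := potSeries ^ 2 + PowerSeries.X ^ 2 * (coeffDeriv totalD gradSeries) ^ 2
      - 2 * PowerSeries.X * gradSeries ^ 2 with hN
  have h2 : coeffDeriv totalD (2 : PowerSeries DiffPoly) = 0 := Derivation.map_natCast _ 2
  have hD : coeffDeriv totalD N = 0 := by
    rw [hN, pow_two, pow_two, pow_two, pow_two]
    simp only [map_add, map_sub, Derivation.leibniz, smul_eq_mul, coeffDeriv_X, h2,
      coeffDeriv_potSeries]
    linear_combination 2 * PowerSeries.X * coeffDeriv totalD gradSeries *
      X_mul_coeffDeriv_gradSeries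
  have hc : PowerSeries.map (constantCoeff (σ := ℕ) (R := ℝ)) N = 4 := by
    have h1 : PowerSeries.map (constantCoeff (σ := ℕ) (R := ℝ)) gradSeries = 0 := by
      ext1 n; simp [gradSeries, constantCoeff_gradPoly]
    have h3 : PowerSeries.map (constantCoeff (σ := ℕ) (R := ℝ)) (coeffDeriv totalD gradSeries)
        = 0 := by
      ext1 n; simp [coeff_coeffDeriv, constantCoeff_totalD]
    have h4 : PowerSeries.map (constantCoeff (σ := ℕ) (R := ℝ)) (PowerSeries.mk potPoly) = 0 := by
      ext1 n; simp [constantCoeff_potPoly]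
    rw [hN, potSeries]
    simp only [map_add, map_sub, map_mul, map_pow, h1, h3, h4, map_ofNat]
    norm_num
  ext1 n
  have hDn := congrArg (PowerSeries.coeff n) hD
  have hcn := congrArg (PowerSeries.coeff n) hc
  rw [coeff_coeffDeriv, map_zero] at hDn
  rw [PowerSeries.coeff_map] at hcn
  refine eq_of_totalD_eq ?_ ?_
  · rw [hDn, ← coeff_coeffDeriv, show coeffDeriv totalD (4 : PowerSeries DiffPoly) = 0 from
      Derivation.map_natCast _ 4, map_zero]
  · rw [hcn, ← PowerSeries.coeff_map]
    exact congrArg _ (map_ofNat (PowerSeries.map (constantCoeff (σ := ℕ) (R := ℝ))) 4).symm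

/-- The generating function form of `δ/δu ∫ potPoly n = (2 n + 1) gradPoly n`: the difference is
the total derivative of the determinant of the solution `(gradSeries, D_s gradSeries, potSeries)`
of the spectral problem, its variation, and its derivative in the spectral parameter. -/
theorem trace_identity (v : DiffPoly) :
    PowerSeries.C v * (2 * eulerD gradSeries + gradSeries)
        - coeffDeriv (evolD v) (PowerSeries.mk potPoly) ∈
      Set.range fun f => coeffDeriv totalD f := by
  have two (d : Derivation ℝ (PowerSeries DiffPoly) (PowerSeries DiffPoly)) : d 2 = 0 :=
    Derivation.map_natCast _ 2
  have four (d : Derivation ℝ (PowerSeries DiffPoly) (PowerSeries DiffPoly)) : d 4 = 0 :=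
    Derivation.map_natCast _ 4
  have comm (f : PowerSeries DiffPoly) : coeffDeriv totalD (coeffDeriv (evolD v) f)
      = coeffDeriv (evolD v) (coeffDeriv totalD f) := by
    ext1 n
    simp only [coeff_coeffDeriv, evolD_totalD]
  have hu : coeffDeriv (evolD v) (PowerSeries.C (X 0)) = PowerSeries.C v := by
    rw [coeffDeriv_C, evolD_X]; rfl
  have hpot : coeffDeriv (evolD v) potSeries =
      PowerSeries.X * coeffDeriv (evolD v) (PowerSeries.mk potPoly) := by
    rw [potSeries, map_add, two, Derivation.leibniz, coeffDeriv_X]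
    simp
  have hK := X_mul_coeffDeriv_gradSeries
  have hQ := coeffDeriv_potSeries
  have hN := series_norm
  generalize PowerSeries.mk potPoly = W at *
  set z : PowerSeries DiffPoly := PowerSeries.X with hz
  set u : PowerSeries DiffPoly := PowerSeries.C (X 0)
  set L := gradSeries
  set Q := potSeries
  set K := coeffDeriv totalD L with hKdef
  set δ := coeffDeriv (evolD v)
  set D := coeffDeriv totalD
  have hδK := congrArg δ hK
  have hθK := congrArg eulerD hK
  have hδQ := congrArg δ hQ
  have hθQ := congrArg eulerD hQ
  have hδN := congrArg δ hN
  have hθN := congrArg eulerD hN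
  have hδz : δ z = 0 := coeffDeriv_X _
  have hDz : D z = 0 := coeffDeriv_X _
  have hθz : eulerD z = z := eulerD_X
  have hθu : eulerD u = 0 := eulerD_C _
  simp only [map_sub, map_add, pow_two, Derivation.leibniz, smul_eq_mul, two, four, hδz, hθz, hu,
    hθu] at hδK hθK hδQ hθQ hδN hθN
  have hDθ (f : PowerSeries DiffPoly) : D (eulerD f) = eulerD (D f) := eulerD_coeffDeriv _ f
  rw [← comm] at hδK hδQ
  rw [← hDθ] at hθK hθQ
  -- The third row `(2 θL + L, 2 θK + 2 K, 2 θQ)`, with `θ = z d/dz`, is `2 θ` applied to `√z L`, `z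
  -- K`, `Q`, with the powers of `z` divided out again. In the derivative of the determinant only
  -- the variations of the coefficients of the linear system survive. The extra `z` is there because
  -- the equation for `D_s K` is available only multiplied by `z`.
  have key : 2 * (z * D (z * (L * (δ K * (2 * eulerD Q) - δ Q * (2 * eulerD K + 2 * K))
      - K * (δ L * (2 * eulerD Q) - δ Q * (2 * eulerD L + L))
      + Q * (δ L * (2 * eulerD K + 2 * K) - δ K * (2 * eulerD L + L)))))
      = 8 * (z * (PowerSeries.C v * (2 * eulerD L + L) - δ W)) := by
    have hDL : D L = K := rfl
    have hDδL : D (δ L) = δ K := by rw [comm]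
    have hDθL : D (eulerD L) = eulerD K := hDθ L
    simp only [map_sub, map_add, Derivation.leibniz, smul_eq_mul, two, hDz, hDL, hDδL, hDθL, hQ]
    linear_combination 2 * z * (L * (2 * eulerD Q) - Q * (2 * eulerD L + L)) * hδK
      + 4 * z * (Q * δ L - L * δ Q) * hθK
      - 2 * z * (δ L * (2 * eulerD Q) - δ Q * (2 * eulerD L + L)) * hK
      + 2 * z ^ 2 * (K * (2 * eulerD L + L) - L * (2 * eulerD K + 2 * K)) * hδQ
      + 4 * z ^ 2 * (L * δ K - K * δ L) * hθQ
      + 2 * (z * PowerSeries.C v * (2 * eulerD L + L) - δ Q) * hN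
      - 2 * z * PowerSeries.C v * L * hθN + Q * hδN - 8 * hpot
  refine ⟨(1 / 4 : ℝ) • (z * (L * (δ K * (2 * eulerD Q) - δ Q * (2 * eulerD K + 2 * K))
      - K * (δ L * (2 * eulerD Q) - δ Q * (2 * eulerD L + L))
      + Q * (δ L * (2 * eulerD K + 2 * K) - δ K * (2 * eulerD L + L)))), ?_⟩
  -- Cancel the auxiliary factors `z` and `2` of `key`.
  refine mul_left_cancel₀ (PowerSeries.X_ne_zero (R := DiffPoly)) ?_
  refine smul_right_injective _ (two_ne_zero (α := ℝ)) ?_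
  have h8 : (8 : PowerSeries DiffPoly) = algebraMap ℝ _ 8 := (map_ofNat _ 8).symm
  have h2 : (2 : PowerSeries DiffPoly) = algebraMap ℝ _ 2 := (map_ofNat _ 2).symm
  rw [h8, ← Algebra.smul_def] at key
  nth_rw 1 [h2] at key
  rw [← Algebra.smul_def] at key
  simp only [Derivation.map_smul, mul_smul_comm]
  rw [smul_comm, key, smul_smul, ← hz]
  norm_num

theorem evolD_potPoly_sub_mem (v : DiffPoly) (n : ℕ) :
    evolD v (potPoly n) - (2 * n + 1) * gradPoly n * v ∈ exactPolys := by
  obtain ⟨f, hf⟩ := trace_identity v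
  have h := congrArg (PowerSeries.coeff n) hf
  have h2 : ∀ g : PowerSeries DiffPoly, PowerSeries.coeff n (2 * g) = 2 * PowerSeries.coeff n g :=
    fun g => PowerSeries.coeff_C_mul n g 2
  simp only [map_sub, coeff_coeffDeriv, PowerSeries.coeff_C_mul, map_add, h2, coeff_eulerD,
    PowerSeries.coeff_mk, gradSeries] at h
  rw [← neg_sub]
  refine exactPolys.neg_mem ⟨_, h.trans ?_⟩
  ring

theorem varDeriv_C_mul_potPoly (n : ℕ) (a : ℝ) :
    varDeriv (C a * potPoly n) = C a * (2 * (n : DiffPoly) + 1) * gradPoly n := by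
  refine varDeriv_eq_of_forall fun v => ?_
  have h := exactPolys.smul_mem a (evolD_potPoly_sub_mem v n)
  convert h using 1
  rw [C_mul', Derivation.map_smul, smul_sub, ← C_mul', ← C_mul']
  ring

theorem exists_isMKdVDensity (n : ℕ) (hn : 1 ≤ n) : ∃ p, IsMKdVDensity n p := by
  obtain ⟨k, rfl⟩ := Nat.exists_eq_add_of_le' hn
  -- The trace identity contributes `2 k + 1`; the other factor `2` is the one in `2 D_s δĤ/δu`.
  have hv : varDeriv (C (1 / (2 * (2 * k + 1)) : ℝ) * potPoly k) = C (1 / 2 : ℝ) * gradPoly k := by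
    rw [varDeriv_C_mul_potPoly]
    congr 1
    rw [show ((2 : DiffPoly) * (k : DiffPoly) + 1) = C (2 * k + 1 : ℝ) by
      rw [C_add, C_mul, C_1, show (C 2 : DiffPoly) = 2 from rfl, map_natCast], ← C_mul]
    congr 1
    have : (2 * k + 1 : ℝ) ≠ 0 := by positivity
    field_simp
  refine ⟨C (1 / (2 * (2 * k + 1)) : ℝ) * potPoly k, k, rfl, ?_, ?_, ?_⟩
  · rw [map_mul, constantCoeff_potPoly, mul_zero]
  · rw [hv, map_mul, constantCoeff_gradPoly, mul_zero]
  · rw [hv, totalD_C_mul, ← mul_assoc, show (2 : DiffPoly) = C 2 from rfl, ← C_mul]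
    norm_num
    exact isMKdVFlow_gradPoly k


end

/-! ### Smooth periodic functions -/

/-- Smooth functions on the circle with values in a normed space. -/
def IsSmoothPer {E : Type*} [NormedAddCommGroup E] [NormedSpace ℝ E] (f : ℝ → E) : Prop :=
  ContDiff ℝ ∞ f ∧ ∀ s, f (s + 2 * Real.pi) = f s

namespace IsSmoothPer

variable {E : Type*} [NormedAddCommGroup E] [NormedSpace ℝ E] {f g : ℝ → E}

theorem hasDerivAt (hf : IsSmoothPer f) (s : ℝ) : HasDerivAt f (deriv f s) s :=
  (hf.1.differentiable (by simp) s).hasDerivAt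

theorem deriv (hf : IsSmoothPer f) : IsSmoothPer (deriv f) :=
  ⟨(contDiff_infty_iff_deriv.mp hf.1).2, fun s => by
    rw [← deriv_comp_add_const]
    congr 1
    exact funext hf.2⟩

theorem const (c : E) : IsSmoothPer fun _ : ℝ => c := ⟨contDiff_const, fun _ => rfl⟩

theorem add (hf : IsSmoothPer f) (hg : IsSmoothPer g) : IsSmoothPer fun s => f s + g s :=
  ⟨hf.1.add hg.1, fun s => by simp only [hf.2, hg.2]⟩

theorem sub (hf : IsSmoothPer f) (hg : IsSmoothPer g) : IsSmoothPer fun s => f s - g s :=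
  ⟨hf.1.sub hg.1, fun s => by simp only [hf.2, hg.2]⟩

theorem mul {A : Type*} [NormedRing A] [NormedAlgebra ℝ A] {f g : ℝ → A}
    (hf : IsSmoothPer f) (hg : IsSmoothPer g) : IsSmoothPer fun s => f s * g s :=
  ⟨hf.1.mul hg.1, fun s => by simp only [hf.2, hg.2]⟩

theorem ofReal {f : ℝ → ℝ} (hf : IsSmoothPer f) : IsSmoothPer fun s => (f s : ℂ) :=
  ⟨Complex.ofRealCLM.contDiff.comp hf.1, fun s => by simp only [hf.2]⟩

theorem continuous (hf : IsSmoothPer f) : Continuous f := hf.1.continuous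

theorem comp_add (hf : IsSmoothPer f) (σ : ℝ) : IsSmoothPer fun s => f (s + σ) :=
  ⟨hf.1.comp (contDiff_id.add contDiff_const), fun s => by
    simp only [show s + 2 * Real.pi + σ = s + σ + 2 * Real.pi by ring, hf.2]⟩

theorem integral_comp_add (hf : IsSmoothPer f) (σ : ℝ) :
    ∫ s in (0 : ℝ)..(2 * Real.pi), f (s + σ) = ∫ s in (0 : ℝ)..(2 * Real.pi), f s := by
  have h : Function.Periodic f (2 * Real.pi) := hf.2
  rw [intervalIntegral.integral_comp_add_right, zero_add, add_comm (2 * Real.pi),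
    h.intervalIntegral_add_eq σ 0, zero_add]

theorem integral_deriv [CompleteSpace E] (hf : IsSmoothPer f) :
    ∫ s in (0 : ℝ)..(2 * Real.pi), _root_.deriv f s = 0 := by
  rw [intervalIntegral.integral_deriv_eq_sub (fun s _ => hf.1.differentiable (by simp) s)
    (hf.deriv.continuous.intervalIntegrable _ _)]
  rw [← zero_add (2 * Real.pi), hf.2, sub_self]

/-- Functions that differ by the derivative of a periodic function have the same integral. -/
theorem integral_eq [CompleteSpace E] {H : ℝ → E} (hf : IsSmoothPer f) (hg : IsSmoothPer g)
    (hH : IsSmoothPer H) (h : ∀ s, HasDerivAt H (f s - g s) s) :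
    ∫ s in (0 : ℝ)..(2 * Real.pi), f s = ∫ s in (0 : ℝ)..(2 * Real.pi), g s := by
  rw [← sub_eq_zero, ← intervalIntegral.integral_sub (hf.continuous.intervalIntegrable _ _)
    (hg.continuous.intervalIntegrable _ _), ← hH.integral_deriv]
  simp only [(h _).deriv]

/-- The integral from `0` changes over one period by the mean of `f`, which is zero. -/
theorem exists_primitive [CompleteSpace E] (hf : IsSmoothPer f)
    (h : ∫ s in (0 : ℝ)..(2 * Real.pi), f s = 0) :
    ∃ F : ℝ → E, IsSmoothPer F ∧ ∀ s, _root_.deriv F s = f s := by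
  have hd : ∀ s, HasDerivAt (fun s => ∫ x in (0 : ℝ)..s, f x) (f s) s := fun s =>
    intervalIntegral.integral_hasDerivAt_right (hf.continuous.intervalIntegrable _ _)
      (hf.continuous.stronglyMeasurableAtFilter _ _) hf.continuous.continuousAt
  refine ⟨fun s => ∫ x in (0 : ℝ)..s, f x, ⟨?_, fun s => ?_⟩, fun s => (hd s).deriv⟩
  · rw [contDiff_infty_iff_deriv]
    refine ⟨fun s => (hd s).differentiableAt, ?_⟩
    rw [show _root_.deriv (fun s => ∫ x in (0 : ℝ)..s, f x) = f from funext fun s => (hd s).deriv]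
    exact hf.1
  · have hp : Function.Periodic f (2 * Real.pi) := hf.2
    have h1 := hp.intervalIntegral_add_eq s 0
    rw [zero_add, h] at h1
    have h2 := intervalIntegral.integral_add_adjacent_intervals
      (hf.continuous.intervalIntegrable (μ := MeasureTheory.volume) 0 s)
      (hf.continuous.intervalIntegrable s (s + 2 * Real.pi))
    rw [h1, add_zero] at h2
    exact h2.symm

end IsSmoothPer

/-! ### Lenard chains -/

/-- The operator `½ D_s³ + 2 κ D_s + κ_s`. -/
def lenard (κ q : ℝ → ℂ) (s : ℝ) : ℂ :=
  (1 / 2 : ℂ) * deriv (deriv (deriv q)) s + 2 * κ s * deriv q s + deriv κ s * q s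

/-- A sequence of functions on the circle with `D_s q_{j+1} = (½ D_s³ + 2 κ D_s + κ_s) q_j`. -/
structure IsLenardChain (κ : ℝ → ℂ) (k : ℕ) (q : ℕ → ℝ → ℂ) : Prop where
  circle : ∀ j, j ≤ k → IsSmoothPer (q j)
  step : ∀ j, j < k → ∀ s, deriv (q (j + 1)) s = lenard κ (q j) s

theorem IsSmoothPer.lenard {κ q : ℝ → ℂ} (hκ : IsSmoothPer κ) (hq : IsSmoothPer q) :
    IsSmoothPer (lenard κ q) :=
  (((IsSmoothPer.const _).mul hq.deriv.deriv.deriv).add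
    (((IsSmoothPer.const _).mul hκ).mul hq.deriv)).add (hκ.deriv.mul hq)

/-- Formal skew-adjointness: `H` is the bilinear concomitant, with `H' = p L q + (L p) q`. -/
theorem integral_mul_lenard {κ p q : ℝ → ℂ} (hκ : IsSmoothPer κ) (hp : IsSmoothPer p)
    (hq : IsSmoothPer q) :
    ∫ s in (0 : ℝ)..(2 * Real.pi), p s * lenard κ q s =
      ∫ s in (0 : ℝ)..(2 * Real.pi), -(lenard κ p s) * q s := by
  have hc (c : ℂ) : IsSmoothPer fun _ : ℝ => c := .const c
  refine IsSmoothPer.integral_eq (hp.mul (hκ.lenard hq))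
    (H := fun s => (1 / 2 : ℂ) * (p s * deriv (deriv q) s - deriv p s * deriv q s
      + deriv (deriv p) s * q s) + 2 * κ s * (p s * q s))
    ?_ ?_ fun s => ?_
  · have h := ((hc (-1)).mul (hκ.lenard hp)).mul hq
    simp only [neg_one_mul] at h
    exact h
  · exact ((hc _).mul (((hp.mul hq.deriv.deriv).sub (hp.deriv.mul hq.deriv)).add
      (hp.deriv.deriv.mul hq))).add (((hc 2).mul hκ).mul (hp.mul hq))
  · have h := (((((hp.hasDerivAt s).mul (hq.deriv.deriv.hasDerivAt s)).sub
      ((hp.deriv.hasDerivAt s).mul (hq.deriv.hasDerivAt s))).add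
      ((hp.deriv.deriv.hasDerivAt s).mul (hq.hasDerivAt s))).const_mul (1 / 2 : ℂ)).add
      (((hκ.hasDerivAt s).const_mul 2).mul ((hp.hasDerivAt s).mul (hq.hasDerivAt s)))
    refine h.congr_deriv ?_
    simp only [ClosedCurves.lenard, Pi.mul_apply]
    ring

theorem integral_deriv_mul {A : Type*} [NormedCommRing A] [NormedAlgebra ℝ A] [CompleteSpace A]
    {p q : ℝ → A} (hp : IsSmoothPer p) (hq : IsSmoothPer q) :
    ∫ s in (0 : ℝ)..(2 * Real.pi), -(deriv p s) * q s =
      ∫ s in (0 : ℝ)..(2 * Real.pi), p s * deriv q s := by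
  have hc (c : A) : IsSmoothPer fun _ : ℝ => c := .const c
  refine IsSmoothPer.integral_eq (H := fun s => (-1 : A) * (p s * q s)) ?_ (hp.mul hq.deriv)
    ((hc _).mul (hp.mul hq)) fun s => ?_
  · have h := ((hc (-1)).mul hp.deriv).mul hq
    simp only [neg_one_mul] at h
    exact h
  · exact (((hp.hasDerivAt s).mul (hq.hasDerivAt s)).const_mul (-1 : A)).congr_deriv (by ring)

/-- One exchange is `∫ p_j L q_{i+1} = -∫ (p_{j+1})_s q_{i+1} = ∫ p_{j+1} (q_{i+1})_s = ∫ p_{j+1} L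
q_i`. After `m` exchanges the right side sees only the start of the chain `q`, so the constants of
integration in `q` drop out. -/
theorem IsLenardChain.swap {κ : ℝ → ℂ} {m : ℕ} {p q : ℕ → ℝ → ℂ} (hκ : IsSmoothPer κ)
    (hp : IsLenardChain κ m p) (hq : IsLenardChain κ m q) :
    ∫ s in (0 : ℝ)..(2 * Real.pi), p 0 s * lenard κ (q m) s =
      ∫ s in (0 : ℝ)..(2 * Real.pi), p m s * lenard κ (q 0) s := by
  have key : ∀ j, j ≤ m → ∫ s in (0 : ℝ)..(2 * Real.pi), p 0 s * lenard κ (q m) s =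
      ∫ s in (0 : ℝ)..(2 * Real.pi), p j s * lenard κ (q (m - j)) s := by
    intro j
    induction j with
    | zero => simp
    | succ j ih =>
      intro hj
      rw [ih (by omega), integral_mul_lenard hκ (hp.circle j (by omega)) (hq.circle _ (by omega))]
      simp only [← hp.step j (by omega)]
      rw [integral_deriv_mul (hp.circle _ hj) (hq.circle _ (by omega)),
        show m - j = m - (j + 1) + 1 by omega]
      simp only [hq.step (m - (j + 1)) (by omega)]
  simpa using key m le_rfl

theorem IsLenardChain.mul_add {κ : ℝ → ℂ} {m : ℕ} {p q : ℕ → ℝ → ℂ} (r : ℂ)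
    (hp : IsLenardChain κ m p) (hq : IsLenardChain κ m q) :
    IsLenardChain κ m fun j s => r * p j s + q j s := by
  have hd : ∀ {f g : ℝ → ℂ}, IsSmoothPer f → IsSmoothPer g →
      (deriv fun s => r * f s + g s) = fun s => r * deriv f s + deriv g s := fun hf hg =>
    funext fun s => (((hf.hasDerivAt s).const_mul r).add (hg.hasDerivAt s)).deriv
  refine ⟨fun j hj => ((IsSmoothPer.const r).mul (hp.circle j hj)).add (hq.circle j hj),
    fun j hj s => ?_⟩
  have hpj := hp.circle j hj.le
  have hqj := hq.circle j hj.le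
  rw [hd (hp.circle (j + 1) hj) (hq.circle (j + 1) hj)]
  simp only [hp.step j hj, hq.step j hj, lenard]
  rw [hd hpj hqj, hd hpj.deriv hqj.deriv, hd hpj.deriv.deriv hqj.deriv.deriv]
  ring

theorem lenard_mul_add {κ p q : ℝ → ℂ} (r : ℂ) (hp : IsSmoothPer p) (hq : IsSmoothPer q)
    (s : ℝ) : lenard κ (fun s => r * p s + q s) s = r * lenard κ p s + lenard κ q s := by
  have hd : ∀ {f g : ℝ → ℂ}, IsSmoothPer f → IsSmoothPer g →
      (deriv fun s => r * f s + g s) = fun s => r * deriv f s + deriv g s := fun hf hg =>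
    funext fun s => (((hf.hasDerivAt s).const_mul r).add (hg.hasDerivAt s)).deriv
  simp only [lenard]
  rw [hd hp hq, hd hp.deriv hq.deriv, hd hp.deriv.deriv hq.deriv.deriv]
  ring

theorem lenard_comp_add (κ q : ℝ → ℂ) (σ s : ℝ) :
    lenard (fun s => κ (s + σ)) (fun s => q (s + σ)) s = lenard κ q (s + σ) := by
  have hd (f : ℝ → ℂ) : (deriv fun s => f (s + σ)) = fun s => deriv f (s + σ) :=
    funext fun s => deriv_comp_add_const f σ s
  simp only [lenard, hd]

theorem IsLenardChain.comp_add {κ : ℝ → ℂ} {m : ℕ} {q : ℕ → ℝ → ℂ}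
    (hq : IsLenardChain κ m q) (σ : ℝ) :
    IsLenardChain (fun s => κ (s + σ)) m fun j s => q j (s + σ) :=
  ⟨fun j hj => (hq.circle j hj).comp_add σ, fun j hj s => by
    rw [lenard_comp_add, ← hq.step j hj, deriv_comp_add_const]⟩

/-! ### The Miura transformation and Lenard chains -/

/-- The Miura transformation `u ↦ u² / 4 + i u_s / 2`. -/
def miuraCurv (u : ℝ → ℝ) (s : ℝ) : ℂ :=
  (1 / 4 : ℂ) * ((u s : ℂ) * (u s : ℂ)) + (1 / 2 : ℂ) * (Complex.I * ((deriv u s : ℝ) : ℂ))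

theorem IsSmoothPer.miuraCurv {u : ℝ → ℝ} (hu : IsSmoothPer u) : IsSmoothPer (miuraCurv u) :=
  ((IsSmoothPer.const _).mul (hu.ofReal.mul hu.ofReal)).add
    ((IsSmoothPer.const _).mul ((IsSmoothPer.const _).mul hu.deriv.ofReal))

/-- `q_s + i u q = i l` with a real function `l`: the deformation of a curve with curvature `u`
with velocity `q` in the moving frame rotates the tangent with angular velocity `l`. -/
structure IsRotation (u : ℝ → ℝ) (q : ℝ → ℂ) (l : ℝ → ℝ) : Prop where
  circle : IsSmoothPer q
  real_circle : IsSmoothPer l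
  eq : ∀ s, deriv q s = Complex.I * l s - Complex.I * (u s * q s)

theorem IsSmoothPer.hasDerivAt_ofReal {l : ℝ → ℝ} (hl : IsSmoothPer l) (s : ℝ) :
    HasDerivAt (fun s => (l s : ℂ)) ((_root_.deriv l s : ℝ) : ℂ) s := (hl.hasDerivAt s).ofReal_comp

/-- This is the factorization `L = ½ (D_s - i u) D_s (D_s + i u)`, whose last factor sends `q` to `i
l`. -/
theorem IsRotation.lenard_eq {u : ℝ → ℝ} {q : ℝ → ℂ} {l : ℝ → ℝ} (hu : IsSmoothPer u)
    (h : IsRotation u q l) (s : ℝ) : lenard (miuraCurv u) q s =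
      (1 / 2 : ℂ) * (u s * deriv l s + Complex.I * deriv (deriv l) s) := by
  have hl := h.real_circle
  have h1 : deriv q = fun s => Complex.I * l s - Complex.I * (u s * q s) := funext h.eq
  have h2 : deriv (deriv q) = fun s => Complex.I * deriv l s
      - Complex.I * (deriv u s * q s + u s * deriv q s) := by
    conv_lhs => rw [h1]
    exact funext fun s => (((hl.hasDerivAt_ofReal s).const_mul Complex.I).sub
      (((hu.hasDerivAt_ofReal s).mul (h.circle.hasDerivAt s)).const_mul Complex.I)).deriv
  have h3 : deriv (deriv (deriv q)) s = Complex.I * deriv (deriv l) s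
      - Complex.I * (deriv (deriv u) s * q s + deriv u s * deriv q s
        + (deriv u s * deriv q s + u s * deriv (deriv q) s)) := by
    conv_lhs => rw [h2]
    exact (((hl.deriv.hasDerivAt_ofReal s).const_mul Complex.I).sub
      ((((hu.deriv.hasDerivAt_ofReal s).mul (h.circle.hasDerivAt s)).add
        ((hu.hasDerivAt_ofReal s).mul (h.circle.deriv.hasDerivAt s))).const_mul Complex.I)).deriv
  have h4 : deriv (miuraCurv u) s = (1 / 4 : ℂ) * (deriv u s * u s + u s * deriv u s)
      + (1 / 2 : ℂ) * (Complex.I * deriv (deriv u) s) :=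
    ((((hu.hasDerivAt_ofReal s).mul (hu.hasDerivAt_ofReal s)).const_mul (1 / 4 : ℂ)).add
      (((hu.deriv.hasDerivAt_ofReal s).const_mul Complex.I).const_mul (1 / 2 : ℂ))).deriv
  rw [lenard, h3, h4, h2]
  simp only [h1, miuraCurv]
  have hI : Complex.I ^ 2 = -1 := Complex.I_sq
  have hI3 : Complex.I ^ 3 = -Complex.I := by rw [pow_succ, hI]; ring
  ring_nf
  simp only [hI, hI3]
  ring

/-- Integrating `½ p (u l_s + i l_ss)` by parts gives `½ (u p - i p_s) l_s`, and `u p - i p_s = k`.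
This is why the form is real. -/
theorem IsRotation.integral_mul_lenard {u : ℝ → ℝ} {p q : ℝ → ℂ} {k l : ℝ → ℝ}
    (hu : IsSmoothPer u) (hp : IsRotation u p k) (hq : IsRotation u q l) :
    ∫ s in (0 : ℝ)..(2 * Real.pi), p s * lenard (miuraCurv u) q s =
      ((1 / 2 * ∫ s in (0 : ℝ)..(2 * Real.pi), k s * deriv l s : ℝ) : ℂ) := by
  have hc (c : ℂ) : IsSmoothPer fun _ : ℝ => c := .const c
  have h := IsSmoothPer.integral_eq (hp.circle.mul (hu.miuraCurv.lenard hq.circle))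
    ((hc (1 / 2)).mul (hp.real_circle.mul hq.real_circle.deriv).ofReal)
    (H := fun s => (Complex.I / 2) * (p s * deriv l s))
    ((hc _).mul (hp.circle.mul hq.real_circle.deriv.ofReal)) fun s => by
      refine (((hp.circle.hasDerivAt s).mul
        (hq.real_circle.deriv.hasDerivAt_ofReal s)).const_mul (Complex.I / 2)).congr_deriv ?_
      rw [hq.lenard_eq hu, hp.eq]
      push_cast
      linear_combination (1 / 2 * (k s * ((deriv l s : ℝ) : ℂ) - u s * p s * ((deriv l s : ℝ) : ℂ)) : ℂ) * Complex.I_sq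
  rw [h, intervalIntegral.integral_const_mul, intervalIntegral.integral_ofReal]
  push_cast
  ring

/-- Choosing `w` real keeps the chain within infinitesimal rotations, and the angular velocity
undergoes one step of the mKdV recursion. -/
theorem IsRotation.next {u : ℝ → ℝ} {q : ℝ → ℂ} {l w : ℝ → ℝ} (hu : IsSmoothPer u)
    (h : IsRotation u q l) (hw : IsSmoothPer w) (hwl : ∀ s, deriv w s = u s * deriv l s) :
    IsRotation u (fun s => (1 / 2 : ℂ) * (w s + Complex.I * deriv l s))
        (fun s => (1 / 2 : ℝ) * (deriv (deriv l) s + u s * w s)) ∧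
      ∀ s, deriv (fun s => (1 / 2 : ℂ) * (w s + Complex.I * deriv l s)) s =
        lenard (miuraCurv u) q s := by
  have hl := h.real_circle
  have hd : ∀ s, deriv (fun s => (1 / 2 : ℂ) * (w s + Complex.I * deriv l s)) s =
      (1 / 2 : ℂ) * (u s * deriv l s + Complex.I * deriv (deriv l) s) := fun s => by
    have h1 := (((hw.hasDerivAt_ofReal s).add
      ((hl.deriv.hasDerivAt_ofReal s).const_mul Complex.I)).const_mul (1 / 2 : ℂ)).deriv
    rw [hwl, Complex.ofReal_mul] at h1
    exact h1
  refine ⟨⟨?_, ?_, fun s => ?_⟩, fun s => ?_⟩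
  · exact (IsSmoothPer.const _).mul (hw.ofReal.add ((IsSmoothPer.const _).mul hl.deriv.ofReal))
  · exact (IsSmoothPer.const _).mul (hl.deriv.deriv.add (hu.mul hw))
  · rw [hd]
    push_cast
    linear_combination (1 / 2 * u s * ((deriv l s : ℝ) : ℂ) : ℂ) * Complex.I_sq
  · rw [hd, h.lenard_eq hu]

/-! ### Evaluation of differential polynomials -/

/-- The function `p(u, u_s, u_ss, …)`. -/
def evalDiff (u : ℝ → ℝ) (p : DiffPoly) (s : ℝ) : ℝ :=
  MvPolynomial.eval (fun j : ℕ => iteratedDeriv j u s) p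

theorem IsSmoothPer.iteratedDeriv {u : ℝ → ℝ} (hu : IsSmoothPer u) (j : ℕ) :
    IsSmoothPer (iteratedDeriv j u) := by
  induction j with
  | zero => simpa using hu
  | succ j ih => rw [iteratedDeriv_succ]; exact ih.deriv

theorem IsSmoothPer.evalDiff {u : ℝ → ℝ} (hu : IsSmoothPer u) (p : DiffPoly) :
    IsSmoothPer (evalDiff u p) := by
  unfold ClosedCurves.evalDiff
  induction p using MvPolynomial.induction_on with
  | C a => simpa using IsSmoothPer.const a
  | add p q hp hq => simpa using hp.add hq
  | mul_X p i hp => simpa using hp.mul (hu.iteratedDeriv i)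

theorem hasDerivAt_evalDiff {u : ℝ → ℝ} (hu : IsSmoothPer u) (p : DiffPoly) (s : ℝ) :
    HasDerivAt (evalDiff u p) (evalDiff u (totalD p) s) s := by
  unfold evalDiff
  induction p using MvPolynomial.induction_on with
  | C a => simpa [totalD] using hasDerivAt_const s a
  | add p q hp hq => simp only [map_add]; exact hp.add hq
  | mul_X p i hp =>
    have h := hp.mul ((hu.iteratedDeriv i).hasDerivAt s)
    simp only [Derivation.leibniz, totalD_X, map_add, smul_eq_mul, map_mul, MvPolynomial.eval_X]
    rw [← iteratedDeriv_succ] at h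
    exact h.congr_deriv (by ring)

theorem deriv_evalDiff {u : ℝ → ℝ} (hu : IsSmoothPer u) (p : DiffPoly) :
    deriv (evalDiff u p) = evalDiff u (totalD p) :=
  funext fun s => (hasDerivAt_evalDiff hu p s).deriv

/-! ### The chain of the rotation of the parameter -/

/-- The Lenard chain that starts at the constant function `1`. -/
def shiftChain (u : ℝ → ℝ) : ℕ → ℝ → ℂ
  | 0, _ => 1
  | j + 1, s => (1 / 2 : ℂ) *
      (evalDiff u (potPoly j) s + Complex.I * deriv (evalDiff u (gradPoly j)) s)

/-- The constant `1` rotates the tangent with velocity `u = gradPoly 0`; from there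
`IsRotation.next` with `w = potPoly j` reproduces the recursion of the gradients. -/
theorem isRotation_shiftChain {u : ℝ → ℝ} (hu : IsSmoothPer u) (j : ℕ) :
    IsRotation u (shiftChain u j) (evalDiff u (gradPoly j)) ∧
      ∀ s, deriv (shiftChain u (j + 1)) s = lenard (miuraCurv u) (shiftChain u j) s := by
  have hpot : ∀ j s, deriv (evalDiff u (potPoly j)) s =
      u s * deriv (evalDiff u (gradPoly j)) s := fun j s => by
    rw [deriv_evalDiff hu, deriv_evalDiff hu, totalD_potPoly]
    simp [evalDiff]
  induction j with
  | zero =>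
    have h : IsRotation u (shiftChain u 0) (evalDiff u (gradPoly 0)) := by
      refine ⟨.const 1, hu.evalDiff _, fun s => ?_⟩
      have : shiftChain u 0 = fun _ => 1 := rfl
      simp [this, evalDiff, gradPoly]
    exact ⟨h, (h.next hu (hu.evalDiff _) (hpot 0)).2⟩
  | succ j ih =>
    have h := (ih.1.next hu (hu.evalDiff _) (hpot j)).1
    have h1 : (fun s => (1 / 2 : ℝ) * (deriv (deriv (evalDiff u (gradPoly j))) s
        + u s * evalDiff u (potPoly j) s)) = evalDiff u (gradPoly (j + 1)) := by
      funext s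
      rw [deriv_evalDiff hu, deriv_evalDiff hu, gradPoly_succ]
      simp [evalDiff]
    rw [h1] at h
    exact ⟨h, (h.next hu (hu.evalDiff _) (hpot (j + 1))).2⟩

theorem isLenardChain_shiftChain {u : ℝ → ℝ} (hu : IsSmoothPer u) (m : ℕ) :
    IsLenardChain (miuraCurv u) m (shiftChain u) :=
  ⟨fun j _ => (isRotation_shiftChain hu j).1.circle, fun j _ => (isRotation_shiftChain hu j).2⟩

/-- The swap moves all `m` steps onto the chain of `1`, leaving the `m`-th gradient paired with the
initial curvature variation `l_s`. -/
theorem IsLenardChain.integral_lenard {u : ℝ → ℝ} (hu : IsSmoothPer u) {m : ℕ} {q : ℕ → ℝ → ℂ}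
    (hq : IsLenardChain (miuraCurv u) m q) {l : ℝ → ℝ} (h : IsRotation u (q 0) l) :
    ∫ s in (0 : ℝ)..(2 * Real.pi), shiftChain u 0 s * lenard (miuraCurv u) (q m) s =
      ((1 / 2 * ∫ s in (0 : ℝ)..(2 * Real.pi), evalDiff u (gradPoly m) s * deriv l s : ℝ) : ℂ) := by
  rw [(isLenardChain_shiftChain hu m).swap hu.miuraCurv hq,
    (isRotation_shiftChain hu m).1.integral_mul_lenard hu h]

/-- The Lenard chain of a deformation exists if the deformation preserves the Hamiltonians. -/
theorem exists_isLenardChain {u : ℝ → ℝ} (hu : IsSmoothPer u) {q₀ : ℝ → ℂ} {l₀ : ℝ → ℝ}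
    (h₀ : IsRotation u q₀ l₀) (m : ℕ)
    (h : ∀ j, j < m → ∫ s in (0 : ℝ)..(2 * Real.pi), evalDiff u (gradPoly j) s * deriv l₀ s = 0) :
    ∃ q l, IsLenardChain (miuraCurv u) m q ∧ q 0 = q₀ ∧ IsRotation u (q m) l := by
  induction m with
  | zero => exact ⟨fun _ => q₀, l₀, ⟨fun _ _ => h₀.circle, fun _ h => by omega⟩, rfl, h₀⟩
  | succ m ih =>
    obtain ⟨q, l, hq, rfl, hl⟩ := ih fun j hj => h j (by omega)
    -- Two evaluations of `∫ 1 · L (q m)`: the swapped one vanishes by hypothesis, the direct one is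
    -- `½ ∫ u l_s`, the obstruction to a periodic `w`.
    have h1 := hq.integral_lenard hu h₀
    rw [(isRotation_shiftChain hu 0).1.integral_mul_lenard hu hl, h m (by omega),
      Complex.ofReal_inj] at h1
    have h2 : ∫ s in (0 : ℝ)..(2 * Real.pi), u s * deriv l s = 0 := by
      have h3 : evalDiff u (gradPoly 0) = u := by funext s; simp [evalDiff, gradPoly]
      rw [h3] at h1
      linarith
    obtain ⟨w, hw, hwl⟩ := (hu.mul hl.real_circle.deriv).exists_primitive h2
    obtain ⟨h4, h5⟩ := hl.next hu hw hwl
    refine ⟨fun j => if j ≤ m then q j else fun s => (1 / 2 : ℂ) * (w s + Complex.I * deriv l s),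
      fun s => (1 / 2 : ℝ) * (deriv (deriv l) s + u s * w s),
      ⟨fun j hj => ?_, fun j hj s => ?_⟩, ?_, ?_⟩
    · split_ifs with hjm
      · exact hq.circle j hjm
      · exact h4.circle
    · by_cases hjm : j < m
      · simp only [show j + 1 ≤ m by omega, show j ≤ m by omega, if_true]
        exact hq.step j hjm s
      · obtain rfl : j = m := by omega
        simp only [show ¬ (j + 1 ≤ j) by omega, le_refl, if_true, if_false]
        exact h5 s
    · simp
    · simpa using h4


/-! ### Smooth one-parameter families of functions -/

/-- Smooth one-parameter families of functions on the line. -/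
def IsSmoothFamily {E : Type*} [NormedAddCommGroup E] [NormedSpace ℝ E] (F : ℝ → ℝ → E) : Prop :=
  ContDiff ℝ ∞ (fun x : ℝ × ℝ => F x.1 x.2)

/-- The derivative in the parameter of the family. -/
def derivT {E : Type*} [NormedAddCommGroup E] [NormedSpace ℝ E] (F : ℝ → ℝ → E) (t s : ℝ) : E :=
  deriv (fun t => F t s) t

/-- The derivative along the line. -/
def derivS {E : Type*} [NormedAddCommGroup E] [NormedSpace ℝ E] (F : ℝ → ℝ → E) (t s : ℝ) : E :=
  deriv (F t) s

namespace IsSmoothFamily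

variable {E : Type*} [NormedAddCommGroup E] [NormedSpace ℝ E] {F G : ℝ → ℝ → E}

theorem hasFDerivAt (hF : IsSmoothFamily F) (x : ℝ × ℝ) :
    HasFDerivAt (fun x : ℝ × ℝ => F x.1 x.2) (fderiv ℝ (fun x : ℝ × ℝ => F x.1 x.2) x) x :=
  (hF.differentiable (by simp) x).hasFDerivAt

theorem hasDerivAt_fderiv_t (hF : IsSmoothFamily F) (t s : ℝ) : HasDerivAt (fun t => F t s)
    (fderiv ℝ (fun x : ℝ × ℝ => F x.1 x.2) (t, s) (1, 0)) t :=
  HasFDerivAt.comp_hasDerivAt (f := fun t => (t, s)) t (hF.hasFDerivAt (t, s))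
    ((hasDerivAt_id' t).prodMk (hasDerivAt_const t s))

theorem hasDerivAt_fderiv_s (hF : IsSmoothFamily F) (t s : ℝ) : HasDerivAt (F t)
    (fderiv ℝ (fun x : ℝ × ℝ => F x.1 x.2) (t, s) (0, 1)) s :=
  HasFDerivAt.comp_hasDerivAt (f := fun s => (t, s)) s (hF.hasFDerivAt (t, s))
    ((hasDerivAt_const s t).prodMk (hasDerivAt_id' s))

theorem derivT_eq (hF : IsSmoothFamily F) (t s : ℝ) :
    derivT F t s = fderiv ℝ (fun x : ℝ × ℝ => F x.1 x.2) (t, s) (1, 0) :=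
  (hF.hasDerivAt_fderiv_t t s).deriv

theorem derivS_eq (hF : IsSmoothFamily F) (t s : ℝ) :
    derivS F t s = fderiv ℝ (fun x : ℝ × ℝ => F x.1 x.2) (t, s) (0, 1) :=
  (hF.hasDerivAt_fderiv_s t s).deriv

theorem hasDerivAt_t (hF : IsSmoothFamily F) (t s : ℝ) :
    HasDerivAt (fun t => F t s) (derivT F t s) t :=
  (hF.hasDerivAt_fderiv_t t s).differentiableAt.hasDerivAt

theorem contDiff_fderiv_apply (hF : IsSmoothFamily F) (v : ℝ × ℝ) :
    ContDiff ℝ ∞ fun x => fderiv ℝ (fun x : ℝ × ℝ => F x.1 x.2) x v :=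
  (hF.fderiv_right (by simp)).clm_apply contDiff_const

theorem derivT (hF : IsSmoothFamily F) : IsSmoothFamily (derivT F) := by
  simp only [IsSmoothFamily, hF.derivT_eq]
  exact hF.contDiff_fderiv_apply _

theorem derivS (hF : IsSmoothFamily F) : IsSmoothFamily (derivS F) := by
  simp only [IsSmoothFamily, hF.derivS_eq]
  exact hF.contDiff_fderiv_apply _

theorem derivT_derivS (hF : IsSmoothFamily F) (t s : ℝ) :
    ClosedCurves.derivT (ClosedCurves.derivS F) t s =
      ClosedCurves.derivS (ClosedCurves.derivT F) t s := by
  have hd : DifferentiableAt ℝ (fderiv ℝ fun x : ℝ × ℝ => F x.1 x.2) (t, s) :=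
    (hF.fderiv_right (m := 1) (by norm_cast)).differentiable (by simp) _
  rw [hF.derivS.derivT_eq, hF.derivT.derivS_eq]
  simp only [hF.derivS_eq, hF.derivT_eq]
  rw [fderiv_clm_apply hd (differentiableAt_const _), fderiv_clm_apply hd (differentiableAt_const _)]
  simp only [fderiv_fun_const, Pi.zero_apply, ContinuousLinearMap.comp_zero, zero_add,
    ContinuousLinearMap.flip_apply]
  exact (hF.contDiffAt.isSymmSndFDerivAt (by
    simp only [minSmoothness_of_isRCLikeNormedField]; exact WithTop.coe_le_coe.mpr (le_top (a := (2 : ℕ∞))))).eq _ _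

theorem contDiff (hF : IsSmoothFamily F) (t : ℝ) : ContDiff ℝ ∞ (F t) :=
  ContDiff.comp (g := fun x : ℝ × ℝ => F x.1 x.2) hF (contDiff_const.prodMk contDiff_id)

theorem add (hF : IsSmoothFamily F) (hG : IsSmoothFamily G) :
    IsSmoothFamily fun t s => F t s + G t s := ContDiff.add hF hG

theorem mul {A : Type*} [NormedRing A] [NormedAlgebra ℝ A] {F G : ℝ → ℝ → A}
    (hF : IsSmoothFamily F) (hG : IsSmoothFamily G) :
    IsSmoothFamily fun t s => F t s * G t s := ContDiff.mul hF hG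

theorem const (c : E) : IsSmoothFamily fun _ _ : ℝ => c := contDiff_const

theorem star {F : ℝ → ℝ → ℂ} (hF : IsSmoothFamily F) : IsSmoothFamily fun t s => star (F t s) :=
  Complex.conjCLE.contDiff.comp hF

theorem im {F : ℝ → ℝ → ℂ} (hF : IsSmoothFamily F) : IsSmoothFamily fun t s => (F t s).im :=
  Complex.imCLM.contDiff.comp hF

theorem iterate_derivS (hF : IsSmoothFamily F) (j : ℕ) :
    IsSmoothFamily (fun t s => iteratedDeriv j (F t) s) := by
  induction j with
  | zero => simpa using hF
  | succ j ih => simp only [iteratedDeriv_succ]; exact ih.derivS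

theorem derivT_iteratedDeriv (hF : IsSmoothFamily F) (j : ℕ) (t : ℝ) :
    ClosedCurves.derivT (fun t s => iteratedDeriv j (F t) s) t =
      iteratedDeriv j (ClosedCurves.derivT F t) := by
  induction j with
  | zero => simp
  | succ j ih =>
    rw [iteratedDeriv_succ, ← ih]
    funext s
    simp only [iteratedDeriv_succ]
    exact (hF.iterate_derivS j).derivT_derivS t s

theorem hasDerivAt_integral {F : ℝ → ℝ → ℝ} (hF : IsSmoothFamily F) (a b t : ℝ) :
    HasDerivAt (fun t => ∫ s in a..b, F t s) (∫ s in a..b, ClosedCurves.derivT F t s) t := by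
  have hc : Continuous fun x : ℝ × ℝ => ClosedCurves.derivT F x.1 x.2 := hF.derivT.continuous
  obtain ⟨C, hC⟩ := ((isCompact_Icc (a := t - 1) (b := t + 1)).prod
    (isCompact_uIcc (a := a) (b := b))).exists_bound_of_continuousOn hc.continuousOn
  have hFt : ∀ t, Continuous (F t) := fun t => (hF.contDiff t).continuous
  have hs : Set.Icc (t - 1) (t + 1) ∈ nhds t := Icc_mem_nhds (by linarith) (by linarith)
  refine (intervalIntegral.hasDerivAt_integral_of_dominated_loc_of_deriv_le
    (F := F) (F' := ClosedCurves.derivT F) (bound := fun _ => C) hs ?_ ?_ ?_ ?_ ?_ ?_).2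
  · exact Filter.Eventually.of_forall fun t => (hFt t).aestronglyMeasurable
  · exact (hFt t).intervalIntegrable _ _
  · exact (hF.derivT.contDiff t).continuous.aestronglyMeasurable
  · exact Filter.Eventually.of_forall fun s hs t ht =>
      hC (t, s) ⟨ht, Set.uIoc_subset_uIcc hs⟩
  · exact intervalIntegrable_const
  · exact Filter.Eventually.of_forall fun s _ t _ => hF.hasDerivAt_t t s

theorem evalDiff {U : ℝ → ℝ → ℝ} (hU : IsSmoothFamily U) (p : DiffPoly) :
    IsSmoothFamily fun t s => evalDiff (U t) p s := by
  unfold ClosedCurves.evalDiff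
  induction p using MvPolynomial.induction_on with
  | C a => simpa using IsSmoothFamily.const a
  | add p q hp hq => simpa using hp.add hq
  | mul_X p i hp => simpa using hp.mul (hU.iterate_derivS i)

/-- The chain rule; summing up to any sufficiently large `N` gives sums and products a common range
in the induction. -/
theorem derivT_evalDiff {U : ℝ → ℝ → ℝ} (hU : IsSmoothFamily U) (p : DiffPoly) (t s : ℝ) :
    ∃ N₀, ∀ N, N₀ ≤ N → ClosedCurves.derivT (fun t s => ClosedCurves.evalDiff (U t) p s) t s =
      ∑ j ∈ Finset.range N, ClosedCurves.evalDiff (U t) (MvPolynomial.pderiv j p) s *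
        iteratedDeriv j (ClosedCurves.derivT U t) s := by
  induction p using MvPolynomial.induction_on with
  | C a =>
    refine ⟨0, fun N _ => ?_⟩
    simp [ClosedCurves.evalDiff, ClosedCurves.derivT]
  | add p q hp hq =>
    obtain ⟨N₁, h₁⟩ := hp
    obtain ⟨N₂, h₂⟩ := hq
    refine ⟨max N₁ N₂, fun N hN => ?_⟩
    have h := (((hU.evalDiff p).hasDerivAt_t t s).add ((hU.evalDiff q).hasDerivAt_t t s)).deriv
    rw [h₁ N (le_trans (le_max_left _ _) hN), h₂ N (le_trans (le_max_right _ _) hN),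
      ← Finset.sum_add_distrib] at h
    simp only [ClosedCurves.evalDiff, map_add, add_mul] at h ⊢
    exact h
  | mul_X p i hp =>
    obtain ⟨N₁, h₁⟩ := hp
    refine ⟨max N₁ (i + 1), fun N hN => ?_⟩
    have h := (((hU.evalDiff p).hasDerivAt_t t s).mul
      ((hU.iterate_derivS i).hasDerivAt_t t s)).deriv
    rw [h₁ N (le_trans (le_max_left _ _) hN), hU.derivT_iteratedDeriv] at h
    have hi : i ∈ Finset.range N := by
      have := le_trans (le_max_right _ _) hN
      simpa using this
    simp only [MvPolynomial.pderiv_mul, ClosedCurves.evalDiff, map_add, map_mul, add_mul,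
      MvPolynomial.eval_X, Finset.sum_add_distrib] at h ⊢
    refine h.trans ?_
    congr 1
    · rw [Finset.sum_mul]
      exact Finset.sum_congr rfl fun j _ => by ring
    · rw [Finset.sum_eq_single i]
      · simp
      · intro j _ hj
        rw [MvPolynomial.pderiv_X_of_ne (Ne.symm hj)]
        simp
      · exact fun h => absurd hi h

end IsSmoothFamily

/-! ### First variation of the functionals. -/

theorem integral_evalDiff_mul_iteratedDeriv {u v : ℝ → ℝ} (hu : IsSmoothPer u)
    (hv : IsSmoothPer v) (j : ℕ) (q : DiffPoly) :
    ∫ s in (0 : ℝ)..(2 * Real.pi), evalDiff u q s * iteratedDeriv j v s =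
      ∫ s in (0 : ℝ)..(2 * Real.pi),
        evalDiff u ((-1 : DiffPoly) ^ j * (fun q : DiffPoly => totalD q)^[j] q) s * v s := by
  induction j generalizing q with
  | zero => simp
  | succ j ih =>
    rw [iteratedDeriv_succ, ← integral_deriv_mul (hu.evalDiff q) (hv.iteratedDeriv j),
      deriv_evalDiff hu]
    simp only [neg_mul, intervalIntegral.integral_neg]
    rw [ih, ← intervalIntegral.integral_neg]
    simp only [Function.iterate_succ_apply, pow_succ, mul_neg, mul_one, evalDiff, map_neg, neg_mul]

/-- The first variation formula. -/
theorem integral_derivT_evalDiff {U : ℝ → ℝ → ℝ} (hU : IsSmoothFamily U)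
    (hper : ∀ t, IsSmoothPer (U t)) (hper' : ∀ t, IsSmoothPer (derivT U t)) (p : DiffPoly)
    (t : ℝ) :
    ∫ s in (0 : ℝ)..(2 * Real.pi), derivT (fun t s => evalDiff (U t) p s) t s =
      ∫ s in (0 : ℝ)..(2 * Real.pi), evalDiff (U t) (varDeriv p) s * derivT U t s := by
  have h1 : ∀ s, derivT (fun t s => evalDiff (U t) p s) t s =
      ∑ j ∈ p.vars, evalDiff (U t) (MvPolynomial.pderiv j p) s *
        iteratedDeriv j (derivT U t) s := by
    intro s
    obtain ⟨N₀, hN⟩ := hU.derivT_evalDiff p t s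
    rw [hN (max N₀ (p.vars.sup id + 1)) (le_max_left _ _)]
    symm
    refine Finset.sum_subset (fun j hj => ?_) fun j _ hj => ?_
    · have := Finset.le_sup (f := id) hj
      simp only [id] at this
      simp only [Finset.mem_range]
      omega
    · rw [MvPolynomial.pderiv_eq_zero_of_notMem_vars hj]
      simp [evalDiff]
  have h2 : ∀ s, evalDiff (U t) (varDeriv p) s * derivT U t s = ∑ j ∈ p.vars,
      evalDiff (U t) ((-1 : DiffPoly) ^ j * (fun q : DiffPoly => totalD q)^[j]
        (MvPolynomial.pderiv j p)) s * derivT U t s := by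
    intro s
    rw [varDeriv, evalDiff, map_sum, Finset.sum_mul]
    rfl
  simp only [h1, h2]
  rw [intervalIntegral.integral_finsetSum, intervalIntegral.integral_finsetSum]
  · exact Finset.sum_congr rfl fun j _ =>
      integral_evalDiff_mul_iteratedDeriv (hper t) (hper' t) j _
  · exact fun j _ => (((hper t).evalDiff _).mul (hper' t)).continuous.intervalIntegrable _ _
  · exact fun j _ => (((hper t).evalDiff _).mul
      ((hper' t).iteratedDeriv j)).continuous.intervalIntegrable _ _

/-! ### Motions of closed curves -/

/-- The components of `V` in the moving frame: `V = (frameComp γ V) γ_s`. -/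
def frameComp (γ V : ℝ → ℂ) (s : ℝ) : ℂ := star (deriv γ s) * V s

/-- The angular velocity of the unit tangent vector under a deformation with velocity `V`. -/
def angVel (γ V : ℝ → ℂ) (s : ℝ) : ℝ := (star (deriv γ s) * deriv V s).im

theorem star_mul_self_of_norm_one {z : ℂ} (h : ‖z‖ = 1) : star z * z = 1 := by
  rw [Complex.star_def, ← Complex.normSq_eq_conj_mul_self, Complex.normSq_eq_norm_sq, h]
  simp

/-- A unit vector moves by rotation. -/
theorem deriv_eq_of_norm_one {f : ℝ → ℂ} {f' : ℂ} {t : ℝ} (h : ∀ t, ‖f t‖ = 1)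
    (hf : HasDerivAt f f' t) : f' = Complex.I * ((star (f t) * f').im : ℝ) * f t := by
  have h1 : HasDerivAt (fun t => star (f t) * f t) (star f' * f t + star (f t) * f') t :=
    hf.star.mul hf
  have h2 : (fun t => star (f t) * f t) = fun _ => 1 :=
    funext fun t => star_mul_self_of_norm_one (h t)
  rw [h2] at h1
  have h3 := h1.unique (hasDerivAt_const t (1 : ℂ))
  have h4 : (star (f t) * f').re = 0 := by
    have := congrArg Complex.re h3
    simp only [Complex.add_re, Complex.mul_re, Complex.star_def, Complex.conj_re, Complex.conj_im,
      Complex.zero_re] at this ⊢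
    linarith
  have h5 : star (f t) * f' = Complex.I * ((star (f t) * f').im : ℝ) := by
    apply Complex.ext
    · rw [h4]; simp
    · rw [Complex.I_mul_im, Complex.ofReal_re]
  rw [← h5, mul_right_comm, star_mul_self_of_norm_one (h t), one_mul]

theorem MHat.isSmoothPer {γ : ℝ → ℂ} (h : γ ∈ MHat) : IsSmoothPer γ := ⟨h.1, h.2.1⟩

theorem IsSmoothPer.star_mul_im {f g : ℝ → ℂ} (hf : IsSmoothPer f) (hg : IsSmoothPer g) :
    IsSmoothPer fun s => (star (f s) * g s).im :=
  ⟨Complex.imCLM.contDiff.comp ((Complex.conjCLE.contDiff.comp hf.1).mul hg.1), fun s => by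
    simp only [hf.2, hg.2]⟩

theorem MHat.curvHat {γ : ℝ → ℂ} (h : γ ∈ MHat) : IsSmoothPer (curvHat γ) :=
  (MHat.isSmoothPer h).deriv.star_mul_im (MHat.isSmoothPer h).deriv.deriv

theorem MHat.deriv_deriv {γ : ℝ → ℂ} (h : γ ∈ MHat) (s : ℝ) :
    deriv (deriv γ) s = Complex.I * ((ClosedCurves.curvHat γ s : ℝ) : ℂ) * deriv γ s :=
  deriv_eq_of_norm_one h.2.2 ((MHat.isSmoothPer h).deriv.hasDerivAt s)

namespace IsMotion

variable {Γ : ℝ → ℝ → ℂ} {γ V : ℝ → ℂ}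

theorem smooth (h : IsMotion Γ γ V) : IsSmoothFamily Γ := h.1

theorem mem (h : IsMotion Γ γ V) : γ ∈ MHat := h.2.2.1 ▸ h.2.1 0

theorem velocity_eq (h : IsMotion Γ γ V) : V = derivT Γ 0 := (funext h.2.2.2).symm

theorem isSmoothPer_derivT (h : IsMotion Γ γ V) (t : ℝ) : IsSmoothPer (derivT Γ t) := by
  refine ⟨h.smooth.derivT.contDiff t, fun s => ?_⟩
  have hp : (fun t => Γ t (s + 2 * Real.pi)) = fun t => Γ t s := funext fun t => (h.2.1 t).2.1 s
  simp only [derivT, hp]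

theorem isSmoothPer (h : IsMotion Γ γ V) : IsSmoothPer V := by
  rw [h.velocity_eq]
  exact h.isSmoothPer_derivT 0

theorem deriv_derivT (h : IsMotion Γ γ V) (t s : ℝ) : deriv (derivT Γ t) s =
    Complex.I * ((angVel (Γ t) (derivT Γ t) s : ℝ) : ℂ) * deriv (Γ t) s := by
  have h1 := deriv_eq_of_norm_one (f := fun t => deriv (Γ t) s) (fun t => (h.2.1 t).2.2 s)
    (h.smooth.derivS.hasDerivAt_t t s)
  rw [h.smooth.derivT_derivS] at h1
  exact h1

theorem deriv_velocity (h : IsMotion Γ γ V) (s : ℝ) :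
    deriv V s = Complex.I * ((angVel γ V s : ℝ) : ℂ) * deriv γ s := by
  rw [h.velocity_eq, h.deriv_derivT, ← h.2.2.1]

/-- Differentiate `q = T̄ V`: here `T̄_s = -i κ̂ T̄` and `T̄ V_s = i l`. -/
theorem isRotation (h : IsMotion Γ γ V) : IsRotation (curvHat γ) (frameComp γ V) (angVel γ V) := by
  have hγ := MHat.isSmoothPer h.mem
  refine ⟨⟨(Complex.conjCLE.contDiff.comp hγ.deriv.1).mul h.isSmoothPer.1, fun s => ?_⟩,
    hγ.deriv.star_mul_im h.isSmoothPer.deriv, fun s => ?_⟩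
  · simp only [frameComp, hγ.deriv.2, h.isSmoothPer.2]
  · have h1 := ((hγ.deriv.hasDerivAt s).star.mul (h.isSmoothPer.hasDerivAt s)).deriv
    refine h1.trans ?_
    rw [MHat.deriv_deriv h.mem, h.deriv_velocity, frameComp]
    have h2 := star_mul_self_of_norm_one (h.mem.2.2 s)
    simp only [star_mul', Complex.star_def, Complex.conj_I, Complex.conj_ofReal] at h2 ⊢
    linear_combination Complex.I * ((angVel γ V s : ℝ) : ℂ) * h2

theorem isSmoothFamily_curvHat (h : IsMotion Γ γ V) :
    IsSmoothFamily fun t => curvHat (Γ t) :=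
  (h.smooth.derivS.star.mul h.smooth.derivS.derivS).im

/-- The curvature evolves by the derivative of the angular velocity. -/
theorem derivT_curvHat (h : IsMotion Γ γ V) (t s : ℝ) :
    derivT (fun t => curvHat (Γ t)) t s = deriv (angVel (Γ t) (derivT Γ t)) s := by
  have hang : IsSmoothPer (angVel (Γ t) (derivT Γ t)) :=
    (MHat.isSmoothPer (h.2.1 t)).deriv.star_mul_im (h.isSmoothPer_derivT t).deriv
  -- Compute `T_st` twice, from `T_s = i κ̂ T` and from `T_t = i l T`; the terms with `κ̂ l` agree
  -- and leave `κ̂_t = l_s`.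
  have h1 : derivT (derivS (derivS Γ)) t s = Complex.I *
      ((derivT (fun t => curvHat (Γ t)) t s : ℝ) : ℂ) * deriv (Γ t) s +
      Complex.I * ((curvHat (Γ t) s : ℝ) : ℂ) * derivT (derivS Γ) t s := by
    have h2 : (fun t => derivS (derivS Γ) t s) =
        fun t => Complex.I * ((curvHat (Γ t) s : ℝ) : ℂ) * derivS Γ t s :=
      funext fun t => MHat.deriv_deriv (h.2.1 t) s
    rw [derivT, h2]
    exact (((h.isSmoothFamily_curvHat.hasDerivAt_t t s).ofReal_comp.const_mul Complex.I).mul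
      (h.smooth.derivS.hasDerivAt_t t s)).deriv
  have h3 : derivT (derivS (derivS Γ)) t s = Complex.I *
      ((deriv (angVel (Γ t) (derivT Γ t)) s : ℝ) : ℂ) * deriv (Γ t) s +
      Complex.I * ((angVel (Γ t) (derivT Γ t) s : ℝ) : ℂ) * deriv (deriv (Γ t)) s := by
    rw [h.smooth.derivS.derivT_derivS]
    have h4 : derivT (derivS Γ) t = fun s => Complex.I *
        ((angVel (Γ t) (derivT Γ t) s : ℝ) : ℂ) * deriv (Γ t) s := by
      funext s
      rw [h.smooth.derivT_derivS]
      exact h.deriv_derivT t s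
    rw [derivS, h4]
    exact (((hang.hasDerivAt_ofReal s).const_mul Complex.I).mul
      ((MHat.isSmoothPer (h.2.1 t)).deriv.hasDerivAt s)).deriv
  have h5 : derivT (derivS Γ) t s = Complex.I * ((angVel (Γ t) (derivT Γ t) s : ℝ) : ℂ) *
      deriv (Γ t) s := by
    rw [h.smooth.derivT_derivS]
    exact h.deriv_derivT t s
  rw [h3, h5, MHat.deriv_deriv (h.2.1 t)] at h1
  have hne : Complex.I * deriv (Γ t) s ≠ 0 := by
    refine mul_ne_zero Complex.I_ne_zero fun h0 => ?_
    have := (h.2.1 t).2.2 s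
    rw [h0, norm_zero] at this
    exact zero_ne_one this
  have h6 : Complex.I * deriv (Γ t) s * ((derivT (fun t => curvHat (Γ t)) t s : ℝ) : ℂ) =
      Complex.I * deriv (Γ t) s * ((deriv (angVel (Γ t) (derivT Γ t)) s : ℝ) : ℂ) := by
    linear_combination -h1
  exact Complex.ofReal_injective (mul_left_cancel₀ hne h6)

theorem hasDerivAt_functionalHat (h : IsMotion Γ γ V) (p : DiffPoly) :
    HasDerivAt (fun t => functionalHat p (Γ t))
      (∫ s in (0 : ℝ)..(2 * Real.pi),
        evalDiff (curvHat γ) (varDeriv p) s * deriv (angVel γ V) s) 0 := by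
  have hU := h.isSmoothFamily_curvHat
  have h1 := (hU.evalDiff p).hasDerivAt_integral 0 (2 * Real.pi) 0
  rw [integral_derivT_evalDiff hU (fun t => MHat.curvHat (h.2.1 t)) ?_ p 0] at h1
  · simp only [h.derivT_curvHat] at h1
    rw [h.velocity_eq, ← h.2.2.1]
    exact h1
  · intro t
    rw [show derivT (fun t => curvHat (Γ t)) t = deriv (angVel (Γ t) (derivT Γ t)) from
      funext (h.derivT_curvHat t)]
    exact IsSmoothPer.deriv ((MHat.isSmoothPer (h.2.1 t)).deriv.star_mul_im
      (h.isSmoothPer_derivT t).deriv)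

end IsMotion


/-! ### Smooth square roots -/

/-- Unit complex numbers that depend smoothly on a point of a vector space have a smooth
argument. -/
theorem exists_contDiff_arg {E : Type*} [NormedAddCommGroup E] [NormedSpace ℝ E] {F : E → ℂ}
    (hF : ContDiff ℝ ∞ F) (h1 : ∀ x, ‖F x‖ = 1) :
    ∃ θ : E → ℝ, ContDiff ℝ ∞ θ ∧ ∀ x, Complex.exp (θ x * Complex.I) = F x := by
  let f : C(E, Circle) := ⟨fun x => ⟨F x, mem_sphere_zero_iff_norm.mpr (h1 x)⟩,
    hF.continuous.subtype_mk _⟩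
  have he : Circle.exp (Complex.arg (F 0)) = f 0 := Circle.exp_arg (f 0)
  obtain ⟨θ, ⟨-, hθ⟩, -⟩ := Circle.isCoveringMap_exp.existsUnique_continuousMap_lifts f 0 _ he
  have hexp : ∀ x, Complex.exp (θ x * Complex.I) = F x := fun x => by
    rw [← Circle.coe_exp]
    exact congrArg Subtype.val (congrFun hθ x)
  refine ⟨θ, contDiff_iff_contDiffAt.mpr fun x₀ => ?_, hexp⟩
  have hne : F x₀ ≠ 0 := by
    rw [← norm_ne_zero_iff, h1]; exact one_ne_zero
  -- Where the continuous lift moves by less than `π`, the principal logarithm of `F x / F x₀`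
  -- recovers its increment, so the lift is smooth.
  have hloc : ∀ᶠ x in nhds x₀, |θ x - θ x₀| < Real.pi := by
    have hc : Continuous fun x => |θ x - θ x₀| := by fun_prop
    have := hc.tendsto x₀
    simp only [sub_self, abs_zero] at this
    exact this.eventually (gt_mem_nhds Real.pi_pos)
  have hsm : ContDiffAt ℝ ∞ (fun x => θ x₀ + (Complex.log (F x / F x₀)).im) x₀ := by
    refine contDiffAt_const.add (Complex.imCLM.contDiff.contDiffAt.comp (g := Complex.imCLM)
      (f := fun x => Complex.log (F x / F x₀)) x₀ ?_)
    refine ContDiffAt.comp (g := Complex.log) x₀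
      ((Complex.contDiffAt_log (n := ∞) ?_).restrict_scalars ℝ) (hF.contDiffAt.div_const _)
    rw [div_self hne]
    exact Complex.one_mem_slitPlane
  refine hsm.congr_of_eventuallyEq ?_
  filter_upwards [hloc] with x hx
  have h2 : F x / F x₀ = Complex.exp (((θ x - θ x₀ : ℝ) : ℂ) * Complex.I) := by
    rw [← hexp x, ← hexp x₀, ← Complex.exp_sub]
    congr 1
    push_cast
    ring
  rw [abs_lt] at hx
  rw [h2, Complex.log_exp]
  · simp
  · simpa using hx.1
  · simpa using hx.2.le

theorem exists_contDiff_sqrt {E : Type*} [NormedAddCommGroup E] [NormedSpace ℝ E] {F : E → ℂ}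
    (hF : ContDiff ℝ ∞ F) (h1 : ∀ x, ‖F x‖ = 1) :
    ∃ G : E → ℂ, ContDiff ℝ ∞ G ∧ ∀ x, G x ^ 2 * F x = 1 := by
  obtain ⟨θ, hθ, hexp⟩ := exists_contDiff_arg hF h1
  refine ⟨fun x => Complex.exp (((-(1 / 2) * θ x : ℝ) : ℂ) * Complex.I), ?_, fun x => ?_⟩
  · exact ((Complex.ofRealCLM.contDiff.comp (contDiff_const.mul hθ)).mul contDiff_const).cexp
  · rw [← hexp x, ← Complex.exp_nat_mul, ← Complex.exp_add, ← Complex.exp_zero]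
    congr 1
    push_cast
    ring

/-- Smooth branches of a square root differ by a sign. -/
theorem eq_or_eq_neg_of_sq_mul_eq {f g F : ℝ → ℂ} (hf : Continuous f) (hg : Continuous g)
    (hf2 : ∀ s, f s ^ 2 * F s = 1) (hg2 : ∀ s, g s ^ 2 * F s = 1) :
    (∀ s, f s = g s) ∨ ∀ s, f s = -g s := by
  have hF : ∀ s, F s ≠ 0 := fun s h0 => by
    have := hf2 s
    rw [h0, mul_zero] at this
    exact zero_ne_one this
  have hg0 : ∀ s, g s ≠ 0 := fun s h0 => by
    have := hg2 s
    rw [h0] at this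
    simp at this
  have h := isPreconnected_univ.eq_or_eq_neg_of_sq_eq hf.continuousOn hg.continuousOn
    (fun s _ => mul_right_cancel₀ (hF s) ((hf2 s).trans (hg2 s).symm)) fun {s} _ => hg0 s
  exact h.imp (fun h s => h (Set.mem_univ s)) fun h s => h (Set.mem_univ s)

/-! ### The geometric Miura transformation -/

theorem exists_isMiura {γ : ℝ → ℂ} (h : γ ∈ MHat) : ∃ δ, IsMiura γ δ := by
  obtain ⟨ρ, hρ, hρ2⟩ := exists_contDiff_sqrt (F := fun s => -deriv γ s)
    (MHat.isSmoothPer h).deriv.1.neg fun s => by rw [norm_neg, h.2.2 s]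
  exact ⟨fun s => (ρ s * γ s, ρ s), ρ, hρ, hρ2, fun s => rfl⟩

/-- The logarithmic derivative of the square root in the Miura transformation. -/
theorem sqrt_deriv_eq {ρ T : ℝ → ℂ} {ρ' c : ℂ} {s : ℝ} (h : ∀ s, ρ s ^ 2 * (-T s) = 1)
    (hρ : HasDerivAt ρ ρ' s) (hT : HasDerivAt T (c * T s) s) : ρ' = -(1 / 2) * c * ρ s := by
  have h1 := (hρ.pow 2).mul hT.neg
  have h2 : (ρ ^ 2 * -T) = fun _ => 1 := funext h
  rw [h2] at h1
  have h3 := h1.unique (hasDerivAt_const s (1 : ℂ))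
  simp only [Pi.pow_apply, Pi.neg_apply] at h3
  have hne : 2 * ρ s * T s ≠ 0 := by
    intro h0
    have := h s
    have h4 : 2 * (ρ s ^ 2 * -T s) = 0 := by linear_combination -ρ s * h0
    rw [this] at h4
    norm_num at h4
  refine mul_left_cancel₀ hne ?_
  push_cast at h3
  linear_combination -h3

theorem IsMiura.exists_root {γ : ℝ → ℂ} {δ : ℝ → ℂ × ℂ} (hγ : γ ∈ MHat) (h : IsMiura γ δ) :
    ∃ ρ : ℝ → ℂ, ContDiff ℝ ∞ ρ ∧ (∀ s, ρ s ^ 2 * (-deriv γ s) = 1) ∧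
      (δ = fun s => (ρ s * γ s, ρ s)) ∧
      (∀ s, HasDerivAt ρ (-(1 / 2) * (Complex.I * ((curvHat γ s : ℝ) : ℂ)) * ρ s) s) := by
  obtain ⟨ρ, hρ, hρ2, hδ⟩ := h
  refine ⟨ρ, hρ, hρ2, funext hδ, fun s => ?_⟩
  have h1 := (hρ.differentiable (by simp) s).hasDerivAt
  rwa [sqrt_deriv_eq hρ2 h1 ((MHat.deriv_deriv hγ s) ▸
    (MHat.isSmoothPer hγ).deriv.hasDerivAt s)] at h1

theorem IsMiura.deriv_eq {γ : ℝ → ℂ} {ρ : ℝ → ℂ} (hγ : γ ∈ MHat)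
    (hρ' : ∀ s, HasDerivAt ρ (-(1 / 2) * (Complex.I * ((curvHat γ s : ℝ) : ℂ)) * ρ s) s) :
    deriv (fun s => (ρ s * γ s, ρ s)) = fun s =>
      (-(1 / 2) * (Complex.I * ((curvHat γ s : ℝ) : ℂ)) * ρ s * γ s + ρ s * deriv γ s,
        -(1 / 2) * (Complex.I * ((curvHat γ s : ℝ) : ℂ)) * ρ s) :=
  funext fun s => (((hρ' s).mul ((MHat.isSmoothPer hγ).hasDerivAt s)).prodMk (hρ' s)).deriv

theorem IsMiura.mem_MC {γ : ℝ → ℂ} {δ : ℝ → ℂ × ℂ} (hγ : γ ∈ MHat) (h : IsMiura γ δ) :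
    δ ∈ MC := by
  obtain ⟨ρ, hρ, hρ2, rfl, hρ'⟩ := h.exists_root hγ
  have hγp := MHat.isSmoothPer hγ
  refine ⟨(hρ.mul hγ.1).prodMk hρ, ?_, fun s => ?_⟩
  · rcases eq_or_eq_neg_of_sq_mul_eq (f := fun s => ρ (s + 2 * Real.pi)) (g := ρ)
      (hρ.continuous.comp (by fun_prop)) hρ.continuous
      (fun s => by rw [← hρ2 (s + 2 * Real.pi), hγp.deriv.2]) hρ2 with h | h
    · exact Or.inl fun s => by simp only [h, hγ.2.1]
    · exact Or.inr fun s => by simp only [h, hγ.2.1, Prod.neg_mk, neg_mul]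
  · rw [IsMiura.deriv_eq hγ hρ', det2]
    linear_combination hρ2 s

/-- The second component of `δ` is `ρ` with `ρ_s = -½ i u ρ`, so `κ = -ρ_ss / ρ = u²/4 + i u_s/2`.
-/
theorem IsMiura.curvC {γ : ℝ → ℂ} {δ : ℝ → ℂ × ℂ} (hγ : γ ∈ MHat) (h : IsMiura γ δ) :
    curvC δ = miuraCurv (curvHat γ) := by
  obtain ⟨ρ, hρ, hρ2, rfl, hρ'⟩ := h.exists_root hγ
  have hγp := MHat.isSmoothPer hγ
  funext s
  rw [ClosedCurves.curvC, IsMiura.deriv_eq hγ hρ']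
  have h2 : HasDerivAt (fun s => -(1 / 2) * (Complex.I * ((curvHat γ s : ℝ) : ℂ)) * ρ s) _ s :=
    ((((MHat.curvHat hγ).hasDerivAt_ofReal s).const_mul Complex.I).const_mul
      (-(1 / 2) : ℂ)).mul (hρ' s)
  have h1 : HasDerivAt (fun s => -(1 / 2) * (Complex.I * ((curvHat γ s : ℝ) : ℂ)) * ρ s * γ s
      + ρ s * deriv γ s) _ s :=
    (h2.mul (hγp.hasDerivAt s)).add ((hρ' s).mul (hγp.deriv.hasDerivAt s))
  rw [(h1.prodMk h2).deriv, MHat.deriv_deriv hγ s, det2, miuraCurv]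
  dsimp only
  have h3 := hρ2 s
  have hI := Complex.I_sq
  generalize ((curvHat γ s : ℝ) : ℂ) = u at *
  generalize ((deriv (curvHat γ) s : ℝ) : ℂ) = u' at *
  generalize deriv γ s = T at *
  generalize ρ s = r at *
  linear_combination (1 / 4 * (u * u) + 1 / 2 * (Complex.I * u')) * h3
    + (1 / 4 * u ^ 2 * r ^ 2 * T) * hI

theorem IsMiura.det2_self {γ : ℝ → ℂ} {δ : ℝ → ℂ × ℂ} (hγ : γ ∈ MHat) (h : IsMiura γ δ) (s : ℝ) :
    det2 (δ s) (deriv δ s) = 1 := (h.mem_MC hγ).2.2 s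

/-! ### Representing functions and the differential of the Miura transformation. -/

theorem Represents.eq_det2 {δ X : ℝ → ℂ × ℂ} {α : ℝ → ℂ} (h : Represents δ α X)
    (hδ : ∀ s, det2 (δ s) (deriv δ s) = 1) (s : ℝ) : α s = det2 (δ s) (X s) := by
  rw [h.2 s]
  have := hδ s
  simp only [det2, Prod.fst_add, Prod.snd_add, Prod.smul_fst, Prod.smul_snd, smul_eq_mul] at this ⊢
  linear_combination -α s * this

theorem Represents.unique {δ X : ℝ → ℂ × ℂ} {α α' : ℝ → ℂ} (h : Represents δ α X)
    (h' : Represents δ α' X) (hδ : ∀ s, det2 (δ s) (deriv δ s) = 1) : α = α' :=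
  funext fun s => (h.eq_det2 hδ s).trans (h'.eq_det2 hδ s).symm

/-- The differential of the Miura transformation. -/
theorem IsMiuraPush.represents {γ V : ℝ → ℂ} {δ W : ℝ → ℂ × ℂ} (h : IsMiuraPush γ δ V W) :
    Represents δ (frameComp γ V) W := by
  obtain ⟨Γ, Δ, hΓ, hΔ, hm, rfl, hW⟩ := h
  have hγ := hΓ.mem
  refine ⟨hΓ.isRotation.circle, fun s => ?_⟩
  have h0 : IsMiura γ (Δ 0) := hΓ.2.2.1 ▸ hm 0
  obtain ⟨ρ, hρ, hρ2, hδ, hρ'⟩ := h0.exists_root hγ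
  have hR : IsSmoothFamily fun t s => (Δ t s).2 := ContDiff.snd hΔ
  have hR2 : ∀ t, (Δ t s).2 ^ 2 * (-derivS Γ t s) = 1 := fun t => by
    obtain ⟨ρ, -, hρ2, hδ⟩ := hm t
    rw [hδ s]
    exact hρ2 s
  have hRt := hR.hasDerivAt_t 0 s
  have hTt := hΓ.smooth.derivS.hasDerivAt_t 0 s
  have hT0 : derivS Γ 0 s = deriv γ s := by rw [derivS, hΓ.2.2.1]
  have hT1 : derivT (derivS Γ) 0 s = Complex.I * ((angVel γ V s : ℝ) : ℂ) * derivS Γ 0 s := by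
    rw [hΓ.smooth.derivT_derivS, hT0, ← hΓ.deriv_velocity, hΓ.velocity_eq, derivS]
  rw [hT1] at hTt
  have hRt' := sqrt_deriv_eq (T := fun t => derivS Γ t s) hR2 hRt hTt
  rw [hRt'] at hRt
  have hfun : (fun t => Δ t s) = fun t => ((Δ t s).2 * Γ t s, (Δ t s).2) := funext fun t => by
    obtain ⟨ρ, -, -, hδ⟩ := hm t
    rw [hδ s]
  have hV : derivT Γ 0 s = frameComp γ V s * deriv γ s := by
    rw [← hΓ.velocity_eq, frameComp]
    linear_combination -V s * star_mul_self_of_norm_one (hγ.2.2 s)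
  have hG := hΓ.smooth.hasDerivAt_t 0 s
  rw [hV] at hG
  have hD : deriv (fun t => ((Δ t s).2 * Γ t s, (Δ t s).2)) 0 = _ :=
    ((hRt.mul hG).prodMk hRt).deriv
  -- With `ρ_t = -½ i l ρ`, the identity `q_s = i l - i κ̂ q` gives `ρ_t = -½ q_s ρ + q ρ_s`; the
  -- first component follows likewise.
  rw [hW, hfun, hD, hΓ.isRotation.eq, hδ, IsMiura.deriv_eq hγ hρ',
    hΓ.2.2.1]
  simp only [Prod.smul_mk, Prod.mk_add_mk, smul_eq_mul]
  refine Prod.ext ?_ ?_ <;> ring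

theorem exists_isMiuraPush {Γ : ℝ → ℝ → ℂ} {γ V : ℝ → ℂ} {δ : ℝ → ℂ × ℂ} (hΓ : IsMotion Γ γ V)
    (hδ : IsMiura γ δ) : ∃ W, IsMiuraPush γ δ V W := by
  obtain ⟨G, hG, hG2⟩ := exists_contDiff_sqrt (F := fun x : ℝ × ℝ => -derivS Γ x.1 x.2)
    (ContDiff.neg hΓ.smooth.derivS) fun x => by rw [norm_neg]; exact (hΓ.2.1 x.1).2.2 x.2
  obtain ⟨ρ, hρ, hρ2, hδ⟩ := hδ
  -- Choose the sign of the two-variable root so that at `t = 0` it continues the prescribed branch.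
  obtain ⟨G, hG, hG2, hG0⟩ : ∃ G : ℝ × ℝ → ℂ, ContDiff ℝ ∞ G ∧
      (∀ x, G x ^ 2 * (-derivS Γ x.1 x.2) = 1) ∧ ∀ s, G (0, s) = ρ s := by
    have hG02 : ∀ s, G (0, s) ^ 2 * (-deriv γ s) = 1 := fun s => by
      rw [← hΓ.2.2.1]; exact hG2 (0, s)
    rcases eq_or_eq_neg_of_sq_mul_eq (f := fun s => G (0, s)) (g := ρ)
      (hG.continuous.comp (by fun_prop)) hρ.continuous hG02 hρ2 with h | h
    · exact ⟨G, hG, hG2, h⟩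
    · exact ⟨fun x => -G x, hG.neg, fun x => by rw [neg_sq]; exact hG2 x,
        fun s => by simp only [h s, neg_neg]⟩
  refine ⟨_, Γ, fun t s => (G (t, s) * Γ t s, G (t, s)), hΓ, ?_, fun t => ?_, ?_, fun s => rfl⟩
  · exact (hG.mul hΓ.1).prodMk hG
  · exact ⟨fun s => G (t, s), hG.comp (contDiff_const.prodMk contDiff_id),
      fun s => hG2 (t, s), fun s => rfl⟩
  · funext s
    rw [hδ s]
    simp only [hG0, hΓ.2.2.1]


/-! ### The form on the level sets -/

/-- `w = ∫ α Ω^(m+1) β_s ds`, in terms of Lenard chains. -/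
def IsPairing (κ : ℝ → ℂ) (m : ℕ) (α β : ℝ → ℂ) (w : ℂ) : Prop :=
  ∃ q, IsLenardChain κ m q ∧ q 0 = β ∧
    w = ∫ s in (0 : ℝ)..(2 * Real.pi), α s * lenard κ (q m) s

/-- The last iterate `Ω^(m+1) β_s = L q_m` needs no primitive, so `m` chain steps suffice. -/
theorem IsLenardChain.isOmegaIterates {κ : ℝ → ℂ} {m : ℕ} {q : ℕ → ℝ → ℂ}
    (hq : IsLenardChain κ m q) :
    IsOmegaIterates κ (q 0) (m + 1) q
      (fun j => if j ≤ m then deriv (q j) else lenard κ (q m)) := by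
  refine ⟨rfl, by simp, fun j hj => hq.circle j (by omega), fun j hj => ?_, fun j hj s => ?_⟩
  · rw [if_pos (by omega)]
  · simp only [show j ≤ m by omega, if_true]
    split_ifs with h
    · exact hq.step j (by omega) s
    · obtain rfl : j = m := by omega
      rfl

theorem IsOmegaIterates.isLenardChain {κ β : ℝ → ℂ} {m : ℕ} {a b : ℕ → ℝ → ℂ}
    (h : IsOmegaIterates κ β (m + 1) a b) :
    IsLenardChain κ m a ∧ b (m + 1) = lenard κ (a m) := by
  have hb : ∀ j, j ≤ m → ∀ s, b (j + 1) s = lenard κ (a j) s := fun j hj s => by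
    rw [h.step j (by omega), ← h.primitive j (by omega), lenard]
  exact ⟨⟨fun j hj => h.circle j (by omega), fun j hj s => by
    rw [h.primitive (j + 1) (by omega), hb j hj.le]⟩, funext (hb m le_rfl)⟩

theorem IsPairing.unique {κ : ℝ → ℂ} {m : ℕ} {p : ℕ → ℝ → ℂ} {β : ℝ → ℂ} {w w' : ℂ}
    (hκ : IsSmoothPer κ) (hp : IsLenardChain κ m p) (h : IsPairing κ m (p 0) β w)
    (h' : IsPairing κ m (p 0) β w') : w = w' := by
  obtain ⟨q, hq, rfl, rfl⟩ := h
  obtain ⟨q', hq', h0, rfl⟩ := h'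
  rw [hp.swap hκ hq, hp.swap hκ hq', h0]

/-- The form, as a real number. -/
def omegaForm (m : ℕ) (γ V V' : ℝ → ℂ) : ℝ :=
  (Classical.epsilon
    (IsPairing (miuraCurv (curvHat γ)) m (frameComp γ V) (frameComp γ V'))).re

theorem integral_gradPoly {h : ℕ → DiffPoly}
    (hh : ∀ n, 1 ≤ n → IsMKdVDensity n (h n))
    (u l : ℝ → ℝ) (j : ℕ) :
    1 / 2 * ∫ s in (0 : ℝ)..(2 * Real.pi), evalDiff u (gradPoly j) s * l s =
      ∫ s in (0 : ℝ)..(2 * Real.pi), evalDiff u (varDeriv (h (j + 1))) s * l s := by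
  rw [← intervalIntegral.integral_const_mul, ← (hh (j + 1) (by omega)).two_mul_varDeriv]
  congr 1
  funext s
  simp only [evalDiff, map_mul, map_ofNat]
  ring

namespace IsTangentHat

variable {h : ℕ → DiffPoly} {m : ℕ} {γ V V' : ℝ → ℂ}

theorem mem (hV : IsTangentHat h m γ V) : γ ∈ MHat := by
  obtain ⟨Γ, hΓ, -⟩ := hV
  exact hΓ.mem

theorem isRotation (hV : IsTangentHat h m γ V) :
    IsRotation (curvHat γ) (frameComp γ V) (angVel γ V) := by
  obtain ⟨Γ, hΓ, -⟩ := hV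
  exact hΓ.isRotation

theorem exists_chain (hh : ∀ n, 1 ≤ n → IsMKdVDensity n (h n)) (hV : IsTangentHat h m γ V) :
    ∃ q l, IsLenardChain (miuraCurv (curvHat γ)) m q ∧ q 0 = frameComp γ V ∧
      IsRotation (curvHat γ) (q m) l := by
  refine exists_isLenardChain (MHat.curvHat hV.mem) hV.isRotation m fun j hj => ?_
  obtain ⟨Γ, hΓ, hd⟩ := hV
  have h1 := (hΓ.hasDerivAt_functionalHat (h (j + 1))).unique (hd (j + 1) (by omega) (by omega))
  rw [← integral_gradPoly hh] at h1
  linarith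

/-- The chain of `V'` gives existence and, being built from rotations, a real value. The chain of
`V` gives uniqueness through the swap, even against complex constants of integration. -/
theorem isPairing_iff (hh : ∀ n, 1 ≤ n → IsMKdVDensity n (h n)) (hV : IsTangentHat h m γ V)
    (hV' : IsTangentHat h m γ V') (w : ℂ) :
    IsPairing (miuraCurv (curvHat γ)) m (frameComp γ V) (frameComp γ V') w ↔
      w = (omegaForm m γ V V' : ℂ) := by
  have hu := MHat.curvHat hV.mem
  obtain ⟨p, -, hp, hp0, -⟩ := hV.exists_chain hh
  obtain ⟨q, l, hq, hq0, hl⟩ := hV'.exists_chain hh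
  have hex : IsPairing (miuraCurv (curvHat γ)) m (frameComp γ V) (frameComp γ V') _ :=
    ⟨q, hq, hq0, rfl⟩
  rw [hV.isRotation.integral_mul_lenard hu hl] at hex
  have heq : ∀ w, IsPairing (miuraCurv (curvHat γ)) m (frameComp γ V) (frameComp γ V') w →
      w = ((1 / 2 * ∫ s in (0 : ℝ)..(2 * Real.pi), angVel γ V s * deriv l s : ℝ) : ℂ) := by
    rw [← hp0] at hex ⊢
    exact fun w hw => hw.unique hu.miuraCurv hp hex
  have hform : (omegaForm m γ V V' : ℂ) =
      ((1 / 2 * ∫ s in (0 : ℝ)..(2 * Real.pi), angVel γ V s * deriv l s : ℝ) : ℂ) := by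
    rw [omegaForm, heq _ (Classical.epsilon_spec ⟨_, hex⟩), Complex.ofReal_re]
  rw [hform]
  exact ⟨heq w, fun hw => hw ▸ hex⟩

theorem omegaForm_eq (hh : ∀ n, 1 ≤ n → IsMKdVDensity n (h n)) (hV : IsTangentHat h m γ V)
    (hV' : IsTangentHat h m γ V') {q : ℕ → ℝ → ℂ}
    (hq : IsLenardChain (miuraCurv (curvHat γ)) m q) (hq0 : q 0 = frameComp γ V') :
    (omegaForm m γ V V' : ℂ) = ∫ s in (0 : ℝ)..(2 * Real.pi),
      frameComp γ V s * lenard (miuraCurv (curvHat γ)) (q m) s :=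
  ((hV.isPairing_iff hh hV' _).mp ⟨q, hq, hq0, rfl⟩).symm

/-- For any branch of the root the representing functions must be the frame components, and `κ` is
the same; hence neither the branch nor the primitives matter. -/
theorem hasOmegaHat_iff (hh : ∀ n, 1 ≤ n → IsMKdVDensity n (h n)) (hV : IsTangentHat h m γ V)
    (hV' : IsTangentHat h m γ V') (w : ℂ) :
    HasOmegaHat (m + 1) γ V V' w ↔ w = (omegaForm m γ V V' : ℂ) := by
  rw [← hV.isPairing_iff hh hV']
  have hγ := hV.mem
  constructor
  · rintro ⟨δ, W, W', hδ, hW, hW', -, α, β, a, b, hα, hβ, hab, rfl⟩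
    rw [hδ.curvC hγ] at hab
    obtain rfl := hα.unique hW.represents (hδ.det2_self hγ)
    obtain rfl := hβ.unique hW'.represents (hδ.det2_self hγ)
    obtain ⟨hc, hb⟩ := hab.isLenardChain
    exact ⟨a, hc, hab.a_zero, by rw [hb]⟩
  · rintro ⟨q, hq, hq0, rfl⟩
    obtain ⟨δ, hδ⟩ := exists_isMiura hγ
    obtain ⟨Γ, hΓ, -⟩ := hV
    obtain ⟨Γ', hΓ', -⟩ := hV'
    obtain ⟨W, hW⟩ := exists_isMiuraPush hΓ hδ
    obtain ⟨W', hW'⟩ := exists_isMiuraPush hΓ' hδ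
    refine ⟨δ, W, W', hδ, hW, hW', hδ.mem_MC hγ, _, _, q,
      fun j => if j ≤ m then deriv (q j) else lenard (miuraCurv (curvHat γ)) (q m),
      hW.represents, hW'.represents, ?_, ?_⟩
    · rw [hδ.curvC hγ, ← hq0]
      exact hq.isOmegaIterates
    · simp

/-- Swap the chains, then use skewness of `L` once more. -/
theorem omegaForm_skew (hh : ∀ n, 1 ≤ n → IsMKdVDensity n (h n)) (hV : IsTangentHat h m γ V)
    (hV' : IsTangentHat h m γ V') : omegaForm m γ V V' = -omegaForm m γ V' V := by
  have hκ := (MHat.curvHat hV.mem).miuraCurv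
  obtain ⟨p, -, hp, hp0, -⟩ := hV.exists_chain hh
  obtain ⟨q, -, hq, hq0, -⟩ := hV'.exists_chain hh
  have h1 := hV.omegaForm_eq hh hV' hq hq0
  have h2 := hV'.omegaForm_eq hh hV hp hp0
  apply Complex.ofReal_injective
  rw [Complex.ofReal_neg, h1, h2, ← hp0, ← hq0, hp.swap hκ hq,
    integral_mul_lenard hκ (hp.circle m le_rfl) (hq.circle 0 (Nat.zero_le _)),
    ← intervalIntegral.integral_neg]
  congr 1
  funext s
  ring

/-- A linear combination of chains is a chain, and any chain computes the form. -/
theorem omegaForm_linear (hh : ∀ n, 1 ≤ n → IsMKdVDensity n (h n)) {V₁ V₂ V₃ : ℝ → ℂ} {r : ℝ}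
    (hV : IsTangentHat h m γ V) (h₁ : IsTangentHat h m γ V₁) (h₂ : IsTangentHat h m γ V₂)
    (h₃ : IsTangentHat h m γ V₃) (he : ∀ s, V₃ s = r * V₁ s + V₂ s) :
    omegaForm m γ V V₃ = r * omegaForm m γ V V₁ + omegaForm m γ V V₂ := by
  have hκ := (MHat.curvHat hV.mem).miuraCurv
  obtain ⟨p, -, hp, hp0, -⟩ := h₁.exists_chain hh
  obtain ⟨q, -, hq, hq0, -⟩ := h₂.exists_chain hh
  have e₁ := hV.omegaForm_eq hh h₁ hp hp0
  have e₂ := hV.omegaForm_eq hh h₂ hq hq0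
  have e₃ := hV.omegaForm_eq hh h₃ (hp.mul_add (r : ℂ) hq) (by
    funext s
    rw [hp0, hq0, frameComp, frameComp, frameComp, he]
    ring)
  apply Complex.ofReal_injective
  have hint : ∀ q : ℝ → ℂ, IsSmoothPer q → IntervalIntegrable (fun s =>
      frameComp γ V s * lenard (miuraCurv (curvHat γ)) q s) MeasureTheory.volume 0
        (2 * Real.pi) := fun q hq =>
    (hV.isRotation.circle.mul (hκ.lenard hq)).continuous.intervalIntegrable _ _
  rw [Complex.ofReal_add, Complex.ofReal_mul, e₁, e₂, e₃,
    ← intervalIntegral.integral_const_mul, ← intervalIntegral.integral_add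
      ((hint _ (hp.circle m le_rfl)).const_mul _) (hint _ (hq.circle m le_rfl))]
  congr 1
  funext s
  rw [lenard_mul_add _ (hp.circle m le_rfl) (hq.circle m le_rfl)]
  ring

end IsTangentHat

/-! ### The action by parameter shift -/

theorem deriv_shift (σ : ℝ) (γ : ℝ → ℂ) : deriv (shift σ γ) = shift σ (deriv γ) :=
  funext fun s => deriv_comp_add_const γ σ s

theorem curvHat_shift (σ : ℝ) (γ : ℝ → ℂ) :
    curvHat (shift σ γ) = fun s => curvHat γ (s + σ) := by
  funext s
  simp only [curvHat, deriv_shift]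
  rfl

theorem frameComp_shift (σ : ℝ) (γ V : ℝ → ℂ) :
    frameComp (shift σ γ) (shift σ V) = fun s => frameComp γ V (s + σ) := by
  funext s
  simp only [frameComp, deriv_shift]
  rfl

theorem miuraCurv_comp_add (σ : ℝ) (u : ℝ → ℝ) :
    miuraCurv (fun s => u (s + σ)) = fun s => miuraCurv u (s + σ) := by
  funext s
  simp only [miuraCurv, deriv_comp_add_const]

theorem shift_mem_MHat {γ : ℝ → ℂ} (h : γ ∈ MHat) (σ : ℝ) : shift σ γ ∈ MHat := by
  have h1 := (MHat.isSmoothPer h).comp_add σ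
  exact ⟨h1.1, h1.2, fun s => by rw [deriv_shift]; exact h.2.2 _⟩

theorem functionalHat_shift {γ : ℝ → ℂ} (h : γ ∈ MHat) (p : DiffPoly) (σ : ℝ) :
    functionalHat p (shift σ γ) = functionalHat p γ := by
  have h1 := ((MHat.curvHat h).evalDiff p).integral_comp_add σ
  simp only [functionalHat, curvHat_shift, iteratedDeriv_comp_add_const]
  exact h1

theorem shift_mem_levelHat {h : ℕ → DiffPoly} {c : ℕ → ℝ} {m : ℕ} {γ : ℝ → ℂ}
    (hγ : γ ∈ levelHat h c m) (σ : ℝ) : shift σ γ ∈ levelHat h c m :=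
  ⟨shift_mem_MHat hγ.1 σ, fun k hk hkm => by
    rw [functionalHat_shift hγ.1, hγ.2 k hk hkm]⟩

theorem IsMotion.shift {Γ : ℝ → ℝ → ℂ} {γ V : ℝ → ℂ} (h : IsMotion Γ γ V) (σ : ℝ) :
    IsMotion (fun t => shift σ (Γ t)) (shift σ γ) (shift σ V) :=
  ⟨ContDiff.comp (g := fun x : ℝ × ℝ => Γ x.1 x.2) h.1
      (contDiff_fst.prodMk (contDiff_snd.add contDiff_const)),
    fun t => shift_mem_MHat (h.2.1 t) σ, by simp only [h.2.2.1], fun s => h.2.2.2 (s + σ)⟩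

theorem IsTangentHat.shift {h : ℕ → DiffPoly} {m : ℕ} {γ V : ℝ → ℂ} (hV : IsTangentHat h m γ V)
    (σ : ℝ) : IsTangentHat h m (shift σ γ) (shift σ V) := by
  obtain ⟨Γ, hΓ, hd⟩ := hV
  refine ⟨_, hΓ.shift σ, fun k hk hkm => ?_⟩
  simp only [functionalHat_shift (hΓ.2.1 _)]
  exact hd k hk hkm

theorem IsTangentHat.omegaForm_shift {h : ℕ → DiffPoly} {m : ℕ} {γ V V' : ℝ → ℂ}
    (hh : ∀ n, 1 ≤ n → IsMKdVDensity n (h n)) (hV : IsTangentHat h m γ V)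
    (hV' : IsTangentHat h m γ V') (σ : ℝ) :
    omegaForm m (ClosedCurves.shift σ γ) (ClosedCurves.shift σ V) (ClosedCurves.shift σ V') =
      omegaForm m γ V V' := by
  have hκ := (MHat.curvHat hV.mem).miuraCurv
  obtain ⟨q, -, hq, hq0, -⟩ := hV'.exists_chain hh
  have h1 := hV.omegaForm_eq hh hV' hq hq0
  have hq' := hq.comp_add σ
  rw [← miuraCurv_comp_add, ← curvHat_shift] at hq'
  have h2 := (hV.shift σ).omegaForm_eq hh (hV'.shift σ) hq' (by rw [frameComp_shift, hq0])
  apply Complex.ofReal_injective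
  rw [h1, h2, frameComp_shift, curvHat_shift, miuraCurv_comp_add,
    ← (hV.isRotation.circle.mul (hκ.lenard (hq.circle m le_rfl))).integral_comp_add σ]
  simp only [lenard_comp_add]

theorem fundamentalField_eq (γ : ℝ → ℂ) : fundamentalField γ = deriv γ := by
  funext s
  have h := deriv_comp_const_add γ s 0
  rw [add_zero] at h
  exact h

theorem isMotion_fundamentalField {γ : ℝ → ℂ} (h : γ ∈ MHat) :
    IsMotion (fun t => shift t γ) γ (fundamentalField γ) :=
  ⟨h.1.comp (contDiff_snd.add contDiff_fst), shift_mem_MHat h,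
    funext fun s => by simp [shift], fun s => rfl⟩

theorem isTangentHat_fundamentalField {γ : ℝ → ℂ} (h : γ ∈ MHat) (H : ℕ → DiffPoly) (m : ℕ) :
    IsTangentHat H m γ (fundamentalField γ) := by
  refine ⟨_, isMotion_fundamentalField h, fun k _ _ => ?_⟩
  simp only [functionalHat_shift h]
  exact hasDerivAt_const 0 _

/-- Here `γ_s` has frame component `1`, the start of `shiftChain`, so the form becomes the first
variation of `Ĥ_{m+1}`. -/
theorem IsTangentHat.omegaForm_fundamentalField {h : ℕ → DiffPoly} {m : ℕ} {γ V : ℝ → ℂ}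
    (hh : ∀ n, 1 ≤ n → IsMKdVDensity n (h n)) (hV : IsTangentHat h m γ V) :
    omegaForm m γ (fundamentalField γ) V = ∫ s in (0 : ℝ)..(2 * Real.pi),
      evalDiff (curvHat γ) (varDeriv (h (m + 1))) s * deriv (angVel γ V) s := by
  obtain ⟨q, -, hq, hq0, -⟩ := hV.exists_chain hh
  have h1 := (isTangentHat_fundamentalField hV.mem h m).omegaForm_eq hh hV hq hq0
  have h2 : frameComp γ (fundamentalField γ) = shiftChain (curvHat γ) 0 := by
    funext s
    rw [fundamentalField_eq]
    exact star_mul_self_of_norm_one (hV.mem.2.2 s)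
  rw [h2, hq.integral_lenard (MHat.curvHat hV.mem) (hq0 ▸ hV.isRotation)] at h1
  rw [Complex.ofReal_injective h1, integral_gradPoly hh]


end ClosedCurves

end

theorem theorem5p3 :
    (∀ n : ℕ, 1 ≤ n → ∃ p, ClosedCurves.IsMKdVDensity n p) ∧
    ∀ (h : ℕ → ClosedCurves.DiffPoly) (_ : ∀ n, 1 ≤ n → ClosedCurves.IsMKdVDensity n (h n))
      (c : ℕ → ℝ) (m : ℕ) (_ : 1 ≤ m),
      ∃ form : (ℝ → ℂ) → (ℝ → ℂ) → (ℝ → ℂ) → ℝ,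
        (∀ γ ∈ ClosedCurves.levelHat h c m, ∀ V V' : ℝ → ℂ,
          ClosedCurves.IsTangentHat h m γ V → ClosedCurves.IsTangentHat h m γ V' →
          ∀ w : ℂ, ClosedCurves.HasOmegaHat (m + 1) γ V V' w ↔ w = (form γ V V' : ℂ)) ∧
        ClosedCurves.IsTwoForm (ClosedCurves.levelHat h c m)
          (ClosedCurves.IsTangentHat h m) form ∧
        ClosedCurves.IsShiftMomentMap (ClosedCurves.levelHat h c m)
          (ClosedCurves.IsTangentHat h m) form (ClosedCurves.functionalHat (h (m + 1))) := by
  refine ⟨ClosedCurves.exists_isMKdVDensity, fun h hh c m _ =>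
    ⟨ClosedCurves.omegaForm m, ?_, ⟨?_, ?_⟩, ⟨?_, ?_, ?_, ?_, ?_, ?_⟩⟩⟩
  · exact fun γ _ V V' hV hV' w => hV.hasOmegaHat_iff hh hV' w
  · exact fun γ _ V V' hV hV' => hV.omegaForm_skew hh hV'
  · exact fun γ _ V V₁ V₂ V₃ r hV h₁ h₂ h₃ he => hV.omegaForm_linear hh h₁ h₂ h₃ he
  · exact fun γ hγ σ => ClosedCurves.shift_mem_levelHat hγ σ
  · exact fun γ _ σ V hV => hV.shift σ
  · exact fun γ _ σ V V' hV hV' => hV.omegaForm_shift hh hV' σ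
  · exact fun γ hγ σ => ClosedCurves.functionalHat_shift hγ.1 _ σ
  · exact fun γ hγ => ClosedCurves.isTangentHat_fundamentalField hγ.1 h m
  · intro γ _ V hV Γ hΓ
    rw [hV.omegaForm_fundamentalField hh]
    exact hΓ.hasDerivAt_functionalHat _
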